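/- For a group $G$ and a subset $A\subseteq G$, let $\Gamma(G,A)$ be the Cayley graph: the undirected graph with vertex set $G$ and an edge between $ag$ and $g$ for all $g\in G$, $a\in A$. The diameter of a connected finite graph is the maximum, over all pairs of vertices, of the length of a shortest path between them. There are absolute constants $c>0$ and $C>0$ such that, for every prime $p$ and every set $A$ of generators of $G=\mathrm{SL}_2(\mathbb{Z}/p\mathbb{Z})$, the Cayley graph $\Gamma(G,A)$ is connected and $$\operatorname{diam}\Gamma(G,A)\le C(\log p)^c .$$ In particular $\operatorname{diam}\Gamma(G,A)\le C(\log|G|)^c$, which is the bound of Babai's conjecture for $G=\mathrm{SL}_2(\mathbb{Z}/p\mathbb{Z})$. -/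

import Mathlib

/-- The Cayley graph `Γ(G, A)`: the vertex set is `G`, and there is an (undirected) edge between
`a * g` and `g` for all `g : G` and `a ∈ A`. Loops (from `a = 1`) are discarded; they do not
affect distances. -/
def cayleyGraph {G : Type*} [Group G] (A : Set G) : SimpleGraph G :=
  SimpleGraph.fromRel fun u v => ∃ a ∈ A, u = a * v

/-! Write `A^n` for `wordBall A n` and `q` for the order of the field. Call an element regular if
the square of its trace is not 4; its centralizer is then a maximal torus, diagonal in a suitable
basis over the algebraic closure. The theorem rests on a growth statement, `IsSymmGenSet.growth`:
over a finite field of odd characteristic with more than three elements, a symmetric generating set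
either fills the group in 156 steps or satisfies `|A|^45 ≤ 2^187 |A^156|^44`. On iteration the
logarithm of the ball grows geometrically while the radius is multiplied by 156, and `log |G| ≤ 4
log p`, so a radius polynomial in `log p` suffices.

For growth, put `K = |A^156| / |A|` and ignore powers of `K` and constants. Escape from subvarieties
(`apply_eq_zero_of_pow_finrank`) supplies elements in general position in boundedly many steps. For
such a `g` the map `(x, y, z) ↦ x g y g z` on a torus has bounded fibres off a small set, so `A^2`
meets a torus in at most `|A|^(1/3)` elements (`card_commute_cube_le`). Hence regular elements have
large conjugation orbits. Orbits with different traces are disjoint, so there are at most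
`|A|^(1/3)` traces. Three traces determine an element up to two choices, so a given trace occurs at
most `|A|^(2/3)` times (`IsSymmGenSet.card_trace_eq_le`). By orbit counting, a torus containing one
short regular element then meets `A^2` in at least `|A|^(1/3)` elements.

This richness is the pivot: a rich torus has a noncentral element in `A^2`, whose conjugates by `A`
are still short, so richness spreads to all conjugate tori (`IsSymmGenSet.card_le_of_conj`). These
are almost disjoint and about `q^2` in number, which forces `|A|` up to about `q^3`. But a set with
`|A|^3 > 32 q^8` already fills the group, by a second moment argument in the unipotent subgroup.
Otherwise `K` must be at least a power of `|A|`. -/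

open scoped Pointwise Kronecker
open Matrix

/-! ### Root counting and the fibres of the triple product map on a torus -/

section Roots

variable {F : Type*} [Field F]

lemma card_le_two_of_quadratic (T : Finset F) (α β γ : F) (h : α ≠ 0 ∨ β ≠ 0)
    (hT : ∀ y ∈ T, α * y ^ 2 + β * y + γ = 0) : T.card ≤ 2 := by
  classical
  set f : Polynomial F := Polynomial.C α * Polynomial.X ^ 2 + Polynomial.C β * Polynomial.X +
    Polynomial.C γ with hf
  have hf0 : f ≠ 0 := by
    intro h0
    have h2 : f.coeff 2 = α := by simp [hf]
    have h1 : f.coeff 1 = β := by simp [hf, Polynomial.coeff_X_pow]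
    rw [h0] at h1 h2
    rcases h with h | h
    · exact h (by simpa using h2.symm)
    · exact h (by simpa using h1.symm)
  refine le_trans (Polynomial.card_le_degree_of_subset_roots (p := f) ?_)
    Polynomial.natDegree_quadratic_le
  intro y hy
  rw [Polynomial.mem_roots hf0]
  simpa [hf, Polynomial.IsRoot] using hT y hy

lemma card_le_four_of_biquadratic (T : Finset F) (α β γ : F) (h : α ≠ 0)
    (hT : ∀ y ∈ T, α * y ^ 4 + β * y ^ 2 + γ = 0) : T.card ≤ 4 := by
  classical
  have h1 : T.card ≤ 2 * (T.image (· ^ 2)).card := by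
    refine Finset.card_le_mul_card_image T 2 fun b _ => ?_
    refine card_le_two_of_quadratic _ 1 0 (-b) (Or.inl one_ne_zero) fun y hy => ?_
    rw [Finset.mem_filter] at hy
    linear_combination hy.2
  have h2 : (T.image (· ^ 2)).card ≤ 2 := by
    refine card_le_two_of_quadratic _ α β γ (Or.inl h) fun y hy => ?_
    obtain ⟨z, hz, rfl⟩ := Finset.mem_image.1 hy
    linear_combination hT z hz
  omega

/-- The map `(x, y, z) ↦ x g y g z` on triples of diagonal matrices has small fibres, when
the entries `a`, `b`, `c` of `g = !![a, b; c, d]` are nonzero. -/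
lemma card_cube_le_of_diagonal [DecidableEq F] {a b c d : F} (ha : a ≠ 0) (hb : b ≠ 0)
    (hc : c ≠ 0) (S : Finset F) (hS : ∀ x ∈ S, x ≠ 0)
    (W : Finset (F × F × F × F))
    (hW : ∀ x ∈ S, ∀ y ∈ S, ∀ z ∈ S,
      (x * z * (a ^ 2 * y + b * c * y⁻¹), x * z⁻¹ * (a * b * y + b * d * y⁻¹),
        x⁻¹ * z * (a * c * y + c * d * y⁻¹), x⁻¹ * z⁻¹ * (b * c * y + d ^ 2 * y⁻¹)) ∈ W) :
    S.card ^ 3 ≤ 512 * W.card := by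
  classical
  -- The fibre argument divides by these two factors. Their product is a quartic in `y` with leading
  -- coefficient `a ^ 3`, so at most four values of `y` are lost.
  set S' := S.filter fun y => a ^ 2 * y ^ 2 + b * c ≠ 0 ∧ a * y ^ 2 + d ≠ 0 with hS'
  have hbad : S.card ≤ S'.card + 4 := by
    have h1 : S'.card + (S.filter fun y => ¬ (a ^ 2 * y ^ 2 + b * c ≠ 0 ∧
        a * y ^ 2 + d ≠ 0)).card = S.card := Finset.card_filter_add_card_filter_not _
    have h2 : (S.filter fun y => ¬ (a ^ 2 * y ^ 2 + b * c ≠ 0 ∧ a * y ^ 2 + d ≠ 0)).card ≤ 4 := by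
      refine card_le_four_of_biquadratic _ (a ^ 3) (a ^ 2 * d + a * b * c) (b * c * d)
        (pow_ne_zero _ ha) fun y hy => ?_
      have h3 : (a ^ 2 * y ^ 2 + b * c) * (a * y ^ 2 + d) = 0 := by
        have := (Finset.mem_filter.1 hy).2
        rw [mul_eq_zero]
        tauto
      linear_combination h3
    omega
  have hfib : (S ×ˢ S' ×ˢ S).card ≤ 8 * W.card := by
    refine Finset.card_le_mul_card_image_of_maps_to (f := fun t : F × F × F =>
      (t.1 * t.2.2 * (a ^ 2 * t.2.1 + b * c * t.2.1⁻¹),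
        t.1 * t.2.2⁻¹ * (a * b * t.2.1 + b * d * t.2.1⁻¹),
        t.1⁻¹ * t.2.2 * (a * c * t.2.1 + c * d * t.2.1⁻¹),
        t.1⁻¹ * t.2.2⁻¹ * (b * c * t.2.1 + d ^ 2 * t.2.1⁻¹))) ?_ 8 ?_
    · rintro ⟨x, y, z⟩ h
      simp only [Finset.mem_product, hS', Finset.mem_filter] at h
      exact hW x h.1 y h.2.1.1 z h.2.2
    rintro ⟨m₁, m₂, m₃, m₄⟩ -
    set Φ := (S ×ˢ S' ×ˢ S).filter fun t : F × F × F =>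
      (t.1 * t.2.2 * (a ^ 2 * t.2.1 + b * c * t.2.1⁻¹),
        t.1 * t.2.2⁻¹ * (a * b * t.2.1 + b * d * t.2.1⁻¹),
        t.1⁻¹ * t.2.2 * (a * c * t.2.1 + c * d * t.2.1⁻¹),
        t.1⁻¹ * t.2.2⁻¹ * (b * c * t.2.1 + d ^ 2 * t.2.1⁻¹)) = (m₁, m₂, m₃, m₄) with hΦ
    have hmem : ∀ x y z, (x, y, z) ∈ Φ → x ≠ 0 ∧ y ≠ 0 ∧ z ≠ 0 ∧ a ^ 2 * y ^ 2 + b * c ≠ 0 ∧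
        a * y ^ 2 + d ≠ 0 ∧ x * z * (a ^ 2 * y ^ 2 + b * c) = m₁ * y ∧
        x * (b * (a * y ^ 2 + d)) = m₂ * y * z ∧ b * c * y ^ 2 + d ^ 2 = m₄ * x * y * z := by
      intro x y z h
      simp only [hΦ, hS', Finset.mem_filter, Finset.mem_product, Prod.mk.injEq] at h
      obtain ⟨⟨hx, ⟨hy, h1, h2⟩, hz⟩, e1, e2, e3, e4⟩ := h
      have hx0 := hS x hx
      have hy0 := hS y hy
      have hz0 := hS z hz
      refine ⟨hx0, hy0, hz0, h1, h2, ?_, ?_, ?_⟩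
      · rw [← e1]; field_simp
      · rw [← e2]; field_simp
      · rw [← e4]; field_simp
    -- The product of the two diagonal entries does not involve `x` or `z`; it leaves a biquadratic
    -- equation for `y`.
    have hy : (Φ.image fun t => t.2.1).card ≤ 4 := by
      refine card_le_four_of_biquadratic _ (a ^ 2 * (b * c)) (a ^ 2 * d ^ 2 + (b * c) ^ 2 - m₁ * m₄)
        (b * c * d ^ 2) (by positivity) fun y hy => ?_
      obtain ⟨⟨x, y, z⟩, h, rfl⟩ := Finset.mem_image.1 hy
      obtain ⟨hx0, hy0, hz0, h1, h2, e1, e2, e4⟩ := hmem x y z h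
      have : (x * z) * ((a ^ 2 * y ^ 2 + b * c) * (b * c * y ^ 2 + d ^ 2)) =
          (x * z) * (m₁ * m₄ * y ^ 2) := by
        linear_combination (b * c * y ^ 2 + d ^ 2) * e1 + (m₁ * y) * e4
      have := mul_left_cancel₀ (mul_ne_zero hx0 hz0) this
      linear_combination this
    -- For fixed `y`, the product of the two entries of the first row contains `x` only through `x ^
    -- 2`; the first entry then determines `z`.
    have hx : Φ.card ≤ 2 * (Φ.image fun t => t.2.1).card := by
      refine Finset.card_le_mul_card_image Φ 2 fun y _ => ?_
      have hinj : Set.InjOn (fun t : F × F × F => t.1) (Φ.filter fun t => t.2.1 = y) := by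
        rintro ⟨x, y₁, z⟩ h ⟨x', y', z'⟩ h' (rfl : x = x')
        simp only [Finset.coe_filter, Set.mem_ofPred_eq] at h h'
        obtain ⟨h, rfl⟩ := h
        obtain ⟨h', rfl⟩ := h'
        obtain ⟨hx0, hy0, hz0, h1, h2, e1, e2, e4⟩ := hmem _ _ _ h
        obtain ⟨-, -, -, -, -, e1', -, -⟩ := hmem _ _ _ h'
        have : (x * (a ^ 2 * y' ^ 2 + b * c)) * z = (x * (a ^ 2 * y' ^ 2 + b * c)) * z' := by
          linear_combination e1 - e1'
        rw [mul_left_cancel₀ (mul_ne_zero hx0 h1) this]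
      rw [← Finset.card_image_of_injOn hinj]
      by_cases hne : (Φ.filter fun t => t.2.1 = y).Nonempty
      swap
      · rw [Finset.not_nonempty_iff_eq_empty.1 hne]; simp
      obtain ⟨⟨x₀, y₀, z₀⟩, h₀⟩ := hne
      obtain ⟨h₀', rfl⟩ := Finset.mem_filter.1 h₀
      obtain ⟨-, hy0, -, h1, h2, -, -, -⟩ := hmem _ _ _ h₀'
      refine card_le_two_of_quadratic _ (b * (a ^ 2 * y₀ ^ 2 + b * c) * (a * y₀ ^ 2 + d)) 0
        (-(m₁ * m₂ * y₀ ^ 2)) (Or.inl (mul_ne_zero (mul_ne_zero hb h1) h2)) fun x hx => ?_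
      obtain ⟨⟨x, y, z⟩, h, rfl⟩ := Finset.mem_image.1 hx
      obtain ⟨h', rfl⟩ := Finset.mem_filter.1 h
      obtain ⟨hx0, hy0, hz0, h1, h2, e1, e2, e4⟩ := hmem _ _ _ h'
      have : z * (b * (a ^ 2 * y ^ 2 + b * c) * (a * y ^ 2 + d) * x ^ 2) =
          z * (m₁ * m₂ * y ^ 2) := by
        linear_combination (x * (b * (a * y ^ 2 + d))) * e1 + (m₁ * y) * e2
      have := mul_left_cancel₀ hz0 this
      simp only
      linear_combination this
    omega
  rw [Finset.card_product, Finset.card_product] at hfib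
  rcases Finset.eq_empty_or_nonempty S with rfl | ⟨s, hs⟩
  · simp
  have hWpos : 1 ≤ W.card := Finset.card_pos.2 ⟨_, hW s hs s hs s hs⟩
  -- Losing four values of `y` costs at most a factor 2 once `S` has more than 8 elements. Smaller
  -- sets are absorbed by `512 = 8 ^ 3`.
  rcases le_or_gt S.card 8 with h8 | h8
  · calc S.card ^ 3 ≤ 8 ^ 3 := Nat.pow_le_pow_left h8 3
      _ ≤ 512 * W.card := by omega
  · have : S.card ≤ 2 * S'.card := by omega
    calc S.card ^ 3 = S.card * (S.card * S.card) := by ring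
      _ ≤ S.card * ((2 * S'.card) * S.card) := by gcongr
      _ = 2 * (S.card * (S'.card * S.card)) := by ring
      _ ≤ 512 * W.card := by omega

end Roots

/-! ### Regular elements and maximal tori -/

section Diagonalization

variable {F K : Type*} [Field F] [Field K]

lemma sl2_mul_apply (g h : SpecialLinearGroup (Fin 2) F) (i j : Fin 2) :
    (g * h) i j = g i 0 * h 0 j + g i 1 * h 1 j := by
  simp [Matrix.mul_apply, Fin.sum_univ_two]

lemma sl2_ext {g h : SpecialLinearGroup (Fin 2) F} (h₀₀ : g 0 0 = h 0 0) (h₀₁ : g 0 1 = h 0 1)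
    (h₁₀ : g 1 0 = h 1 0) (h₁₁ : g 1 1 = h 1 1) : g = h := by
  ext i j
  fin_cases i <;> fin_cases j <;> assumption

/-- Base change along `f` followed by conjugation by `P⁻¹`. -/
def conjMap (f : F →+* K) (P : SpecialLinearGroup (Fin 2) K) :
    SpecialLinearGroup (Fin 2) F →* SpecialLinearGroup (Fin 2) K :=
  (MulAut.conj P⁻¹).toMonoidHom.comp (SpecialLinearGroup.map f)

lemma conjMap_apply (f : F →+* K) (P : SpecialLinearGroup (Fin 2) K)
    (g : SpecialLinearGroup (Fin 2) F) :
    conjMap f P g = P⁻¹ * SpecialLinearGroup.map f g * P := by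
  simp [conjMap]

lemma conjMap_injective (f : F →+* K) (P : SpecialLinearGroup (Fin 2) K) :
    Function.Injective (conjMap f P) := by
  intro g h hgh
  rw [conjMap_apply, conjMap_apply, mul_left_inj, mul_right_inj] at hgh
  ext i j
  apply f.injective
  have := congrArg (fun m : SpecialLinearGroup (Fin 2) K => m i j) hgh
  simpa using this

lemma trace_conjMap (f : F →+* K) (P : SpecialLinearGroup (Fin 2) K)
    (g : SpecialLinearGroup (Fin 2) F) :
    (conjMap f P g).1.trace = f g.1.trace := by
  have : (conjMap f P g).1 = P⁻¹.1 * (SpecialLinearGroup.map f g).1 * P.1 := by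
    rw [conjMap_apply]; rfl
  rw [this, Matrix.trace_mul_comm, ← mul_assoc]
  have h2 : P.1 * P⁻¹.1 = 1 := congrArg Subtype.val (mul_inv_cancel P)
  rw [h2, one_mul]
  simp [Matrix.trace_fin_two]

/-- The discriminant of the characteristic polynomial is `trace ^ 2 - 4`, so there are two distinct
eigenvalues and a basis of eigenvectors. Working over an algebraically closed field treats split and
non-split tori alike. -/
lemma exists_diagonalizing [IsAlgClosed K] (f : F →+* K) (x : SpecialLinearGroup (Fin 2) F)
    (hx : x.1.trace ^ 2 ≠ 4) :
    ∃ P : SpecialLinearGroup (Fin 2) K, conjMap f P x 0 1 = 0 ∧ conjMap f P x 1 0 = 0 ∧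
      conjMap f P x 0 0 ≠ conjMap f P x 1 1 := by
  set X := SpecialLinearGroup.map f x with hX
  have hdet : X 0 0 * X 1 1 - X 0 1 * X 1 0 = 1 := by
    rw [← Matrix.det_fin_two]; exact X.2
  have ht : (X 0 0 + X 1 1) ^ 2 ≠ 4 := by
    intro h
    apply hx
    apply f.injective
    rw [Matrix.trace_fin_two, map_pow, map_add, map_ofNat]
    exact h
  obtain ⟨l, hl⟩ : ∃ l : K, l ^ 2 - (X 0 0 + X 1 1) * l + 1 = 0 := by
    obtain ⟨l, hl⟩ := IsAlgClosed.exists_root (Polynomial.C 1 * Polynomial.X ^ 2 +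
      Polynomial.C (-(X 0 0 + X 1 1)) * Polynomial.X + Polynomial.C (1 : K)) (by
        rw [Polynomial.degree_quadratic one_ne_zero]; decide)
    refine ⟨l, ?_⟩
    simp only [Polynomial.IsRoot, Polynomial.eval_add, Polynomial.eval_mul, Polynomial.eval_C,
      Polynomial.eval_pow, Polynomial.eval_X] at hl
    linear_combination hl
  -- The candidate eigenvectors are, up to sign, the columns of the adjugate of `X - m`; if both
  -- vanish then `X` is scalar and any vector will do.
  have eig : ∀ m : K, m ^ 2 - (X 0 0 + X 1 1) * m + 1 = 0 → ∃ v₀ v₁ : K, (v₀ ≠ 0 ∨ v₁ ≠ 0) ∧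
      X 0 0 * v₀ + X 0 1 * v₁ = m * v₀ ∧ X 1 0 * v₀ + X 1 1 * v₁ = m * v₁ := by
    intro m hm
    by_cases h : X 0 1 = 0 ∧ X 0 0 = m
    · by_cases h' : X 1 0 = 0 ∧ X 1 1 = m
      · exact ⟨1, 0, by simp, by rw [h.2]; ring, by rw [h'.1]; ring⟩
      · refine ⟨m - X 1 1, X 1 0, ?_, ?_, by ring⟩
        · by_contra hc
          push Not at hc
          exact h' ⟨hc.2, (sub_eq_zero.1 hc.1).symm⟩
        · rw [h.1, h.2]; ring
    · refine ⟨X 0 1, m - X 0 0, ?_, by ring, ?_⟩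
      · by_contra hc
        push Not at hc
        exact h ⟨hc.1, (sub_eq_zero.1 hc.2).symm⟩
      · linear_combination -hm - hdet
  set l' := X 0 0 + X 1 1 - l with hl'
  have hll : l ≠ l' := by
    intro h
    apply ht
    have h1 : X 0 0 + X 1 1 = 2 * l := by linear_combination -hl' - h
    rw [h1] at hl ⊢
    linear_combination -4 * hl
  obtain ⟨v₀, v₁, hv, e1, e2⟩ := eig l hl
  obtain ⟨w₀, w₁, hw, e3, e4⟩ := eig l' (by rw [hl']; linear_combination hl)
  have hδ : v₀ * w₁ - v₁ * w₀ ≠ 0 := by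
    intro h
    have k : ∀ u, (l - l') * u = 0 → u = 0 := fun u hu =>
      (mul_eq_zero.1 hu).resolve_left (sub_ne_zero.2 hll)
    have a1 : v₀ * w₀ = 0 := k _ (by linear_combination -w₀ * e1 + v₀ * e3 - X 0 1 * h)
    have a2 : v₀ * w₁ = 0 := k _ (by linear_combination -w₀ * e2 + v₀ * e4 - X 1 1 * h + l * h)
    have a3 : v₁ * w₀ = 0 := by linear_combination a2 - h
    have a4 : v₁ * w₁ = 0 := k _ (by linear_combination -w₁ * e2 + v₁ * e4 + X 1 0 * h)
    simp only [mul_eq_zero] at a1 a2 a3 a4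
    tauto
  set δ := v₀ * w₁ - v₁ * w₀ with hδ'
  let P : SpecialLinearGroup (Fin 2) K := ⟨!![v₀ / δ, w₀; v₁ / δ, w₁], by
    rw [Matrix.det_fin_two_of]; field_simp; rw [hδ']; ring⟩
  let D : SpecialLinearGroup (Fin 2) K := ⟨!![l, 0; 0, l'], by
    rw [Matrix.det_fin_two_of, hl']; linear_combination -hl⟩
  have hXP : X * P = P * D := by
    apply sl2_ext <;> rw [sl2_mul_apply, sl2_mul_apply] <;> simp [P, D]
    · field_simp; linear_combination e1
    · linear_combination e3
    · field_simp; linear_combination e2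
    · linear_combination e4
  have hD : conjMap f P x = D := by
    rw [conjMap_apply, ← hX, mul_assoc, hXP, inv_mul_cancel_left]
  refine ⟨P, ?_⟩
  rw [hD]
  simpa [D] using hll

variable {f : F →+* K} {P : SpecialLinearGroup (Fin 2) K} {x y z : SpecialLinearGroup (Fin 2) F}

lemma commute_of_offDiag_eq_zero (hx₁ : conjMap f P x 0 1 = 0) (hx₂ : conjMap f P x 1 0 = 0)
    (hy₁ : conjMap f P y 0 1 = 0) (hy₂ : conjMap f P y 1 0 = 0) : Commute y x := by
  apply conjMap_injective f P
  rw [map_mul, map_mul]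
  ext i j
  fin_cases i <;> fin_cases j <;>
    simp [Matrix.mul_apply, Fin.sum_univ_two, hx₁, hx₂, hy₁, hy₂, mul_comm]

lemma offDiag_eq_zero_of_commute (hx₁ : conjMap f P x 0 1 = 0) (hx₂ : conjMap f P x 1 0 = 0)
    (hx : conjMap f P x 0 0 ≠ conjMap f P x 1 1) (h : Commute y x) :
    conjMap f P y 0 1 = 0 ∧ conjMap f P y 1 0 = 0 := by
  have h1 := congrArg (conjMap f P) h.eq
  rw [map_mul, map_mul] at h1
  have h01 := congrArg (fun m : SpecialLinearGroup (Fin 2) K => m 0 1) h1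
  have h10 := congrArg (fun m : SpecialLinearGroup (Fin 2) K => m 1 0) h1
  simp [Matrix.mul_apply, Fin.sum_univ_two, hx₁, hx₂] at h01 h10
  constructor
  · have : (conjMap f P x 0 0 - conjMap f P x 1 1) * conjMap f P y 0 1 = 0 := by
      linear_combination -h01
    exact (mul_eq_zero.1 this).resolve_left (sub_ne_zero.2 hx)
  · have : (conjMap f P x 0 0 - conjMap f P x 1 1) * conjMap f P y 1 0 = 0 := by
      linear_combination h10
    exact (mul_eq_zero.1 this).resolve_left (sub_ne_zero.2 hx)

lemma diag_mul_diag (hx₁ : conjMap f P x 0 1 = 0) :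
    conjMap f P x 0 0 * conjMap f P x 1 1 = 1 := by
  have := (conjMap f P x).2
  rw [Matrix.det_fin_two] at this
  have h : (conjMap f P x).1 0 1 = 0 := hx₁
  rw [h, zero_mul, sub_zero] at this
  exact this

/-- The elements commuting with a regular semisimple element are scalar or regular semisimple. -/
lemma trace_sq_ne_four_of_commute (hx : x.1.trace ^ 2 ≠ 4) (h : Commute y x) (h1 : y ≠ 1)
    (h2 : y ≠ -1) : y.1.trace ^ 2 ≠ 4 := by
  intro ht
  let f := algebraMap F (AlgebraicClosure F)
  obtain ⟨P, hx₁, hx₂, hx₃⟩ := exists_diagonalizing f x hx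
  obtain ⟨hy₁, hy₂⟩ := offDiag_eq_zero_of_commute hx₁ hx₂ hx₃ h
  have hd := diag_mul_diag hy₁
  have htr : (conjMap f P y 0 0 + conjMap f P y 1 1) ^ 2 = 4 := by
    have := trace_conjMap f P y
    rw [Matrix.trace_fin_two] at this
    change conjMap f P y 0 0 + conjMap f P y 1 1 = _ at this
    rw [this, ← map_pow, ht, map_ofNat]
  have heq : conjMap f P y 0 0 = conjMap f P y 1 1 := by
    rw [← sub_eq_zero]
    refine pow_eq_zero_iff two_ne_zero |>.1 ?_
    linear_combination htr - 4 * hd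
  have hsq : (conjMap f P y 0 0 - 1) * (conjMap f P y 0 0 + 1) = 0 := by
    linear_combination hd + conjMap f P y 0 0 * heq
  rcases mul_eq_zero.1 hsq with h0 | h0
  · apply h1
    apply conjMap_injective f P
    have h0 := sub_eq_zero.1 h0
    ext i j
    fin_cases i <;> fin_cases j <;> simp [hy₁, hy₂, ← heq, h0]
  · apply h2
    apply conjMap_injective f P
    have h0 := eq_neg_of_add_eq_zero_left h0
    have hm : conjMap f P (-1) = -1 := by
      ext i j
      rw [conjMap_apply]
      have : SpecialLinearGroup.map f (-1 : SpecialLinearGroup (Fin 2) F) = -1 := by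
        ext i j
        fin_cases i <;> fin_cases j <;> simp
      rw [this]
      simp
    rw [hm]
    ext i j
    fin_cases i <;> fin_cases j <;> simp [hy₁, hy₂, ← heq, h0]

/-- Commuting with a regular `y` means being diagonal in its eigenbasis, and diagonal matrices
commute. Thus a torus can be recovered from any one of its regular elements, as the pivot argument
requires. -/
lemma commute_of_commute_commute (hy : y.1.trace ^ 2 ≠ 4)
    (h : Commute y x) (h' : Commute z y) : Commute z x := by
  let f := algebraMap F (AlgebraicClosure F)
  obtain ⟨P, hy₁, hy₂, hy₃⟩ := exists_diagonalizing f y hy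
  obtain ⟨hx₁, hx₂⟩ := offDiag_eq_zero_of_commute hy₁ hy₂ hy₃ h.symm
  obtain ⟨hz₁, hz₂⟩ := offDiag_eq_zero_of_commute hy₁ hy₂ hy₃ h'
  exact commute_of_offDiag_eq_zero hx₁ hx₂ hz₁ hz₂

/-- A maximal torus contains at most two elements of given trace. -/
lemma card_le_two_of_commute_of_trace (hx : x.1.trace ^ 2 ≠ 4) (t : F)
    (S : Finset (SpecialLinearGroup (Fin 2) F)) (hS : ∀ y ∈ S, Commute y x ∧ y.1.trace = t) :
    S.card ≤ 2 := by
  classical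
  let f := algebraMap F (AlgebraicClosure F)
  obtain ⟨P, hx₁, hx₂, hx₃⟩ := exists_diagonalizing f x hx
  have hinj : Set.InjOn (fun y => conjMap f P y 0 0) S := by
    intro y hy z hz hyz
    obtain ⟨hy₁, hy₂⟩ := offDiag_eq_zero_of_commute hx₁ hx₂ hx₃ (hS y hy).1
    obtain ⟨hz₁, hz₂⟩ := offDiag_eq_zero_of_commute hx₁ hx₂ hx₃ (hS z hz).1
    apply conjMap_injective f P
    have h1 := diag_mul_diag hy₁
    have h2 := diag_mul_diag hz₁
    simp only at hyz
    rw [← hyz] at h2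
    have h3 : conjMap f P y 1 1 = conjMap f P z 1 1 :=
      mul_left_cancel₀ (left_ne_zero_of_mul_eq_one h1) (h1.trans h2.symm)
    ext i j
    fin_cases i <;> fin_cases j <;> simp [hy₁, hy₂, hz₁, hz₂, hyz, h3]
  rw [← Finset.card_image_of_injOn hinj]
  -- An element of the torus is determined by its first eigenvalue, a root of `l ^ 2 - t * l + 1`.
  refine card_le_two_of_quadratic _ 1 (-f t) 1 (Or.inl one_ne_zero) fun l hl => ?_
  obtain ⟨y, hy, rfl⟩ := Finset.mem_image.1 hl
  obtain ⟨hy₁, hy₂⟩ := offDiag_eq_zero_of_commute hx₁ hx₂ hx₃ (hS y hy).1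
  have h1 := diag_mul_diag hy₁
  have htr := trace_conjMap f P y
  rw [Matrix.trace_fin_two, (hS y hy).2] at htr
  change conjMap f P y 0 0 + conjMap f P y 1 1 = _ at htr
  linear_combination conjMap f P y 0 0 * htr - h1

end Diagonalization

/-! ### Balls in a group and escape from linear conditions -/

section Escape

/-- The powers of `W` increase, and once two consecutive ones agree the chain is constant. Every
strict step raises the dimension, so this happens at an exponent of at most the total dimension. -/
lemma Submodule.pow_le_pow_finrank {K R : Type*} [Field K] [Ring R] [Algebra K R]
    [FiniteDimensional K R] (W : Submodule K R) (h1 : 1 ≤ W) (n : ℕ) :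
    W ^ n ≤ W ^ Module.finrank K R := by
  have hmono : Monotone fun k => W ^ k := monotone_nat_of_le_succ fun k => by
    rw [pow_succ]
    exact le_mul_of_one_le_right' h1
  obtain ⟨k, hk, hkk⟩ : ∃ k ≤ Module.finrank K R, W ^ k = W ^ (k + 1) := by
    by_contra! hne
    have : ∀ k ≤ Module.finrank K R + 1, k ≤ Module.finrank K ↥(W ^ k) := by
      intro k
      induction k with
      | zero => simp
      | succ k ih =>
        intro hk
        have hlt : W ^ k < W ^ (k + 1) :=
          lt_of_le_of_ne (hmono (Nat.le_succ k)) (hne k (by omega))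
        have := Submodule.finrank_lt_finrank_of_lt hlt
        have := ih (by omega)
        omega
    have h2 := this _ le_rfl
    have h3 := Submodule.finrank_le (W ^ (Module.finrank K R + 1))
    omega
  have hst : ∀ j, W ^ (k + j) = W ^ k := by
    intro j
    induction j with
    | zero => rfl
    | succ j ih => rw [← add_assoc, pow_succ, ih, ← pow_succ, ← hkk]
  calc W ^ n ≤ W ^ (k + n) := hmono (by omega)
    _ = W ^ k := hst n
    _ ≤ _ := hmono hk

variable {G : Type*} [Group G] [DecidableEq G]

/-- The products of `n` elements of `A`. -/
def wordBall (A : Finset G) (n : ℕ) : Finset G := A ^ n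

/-- A symmetric generating set that contains the identity. -/
structure IsSymmGenSet (A : Finset G) : Prop where
  one_mem : 1 ∈ A
  inv_eq : A⁻¹ = A
  closure_eq : Subgroup.closure (A : Set G) = ⊤

lemma mul_mem_wordBall {A : Finset G} {g h : G} {m n k : ℕ} (hg : g ∈ wordBall A m)
    (hh : h ∈ wordBall A n) (hk : m + n = k) : g * h ∈ wordBall A k := by
  rw [wordBall, ← hk, pow_add]
  exact Finset.mul_mem_mul hg hh

lemma mem_wordBall_one {A : Finset G} {g : G} : g ∈ wordBall A 1 ↔ g ∈ A := by
  rw [wordBall, pow_one]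

lemma wordBall_wordBall (A : Finset G) (m n : ℕ) :
    wordBall (wordBall A m) n = wordBall A (m * n) := (pow_mul A m n).symm

lemma exists_of_mem_wordBall_succ {A : Finset G} {g : G} {n : ℕ} (hg : g ∈ wordBall A (n + 1)) :
    ∃ a ∈ A, ∃ h ∈ wordBall A n, a * h = g := by
  rw [wordBall, pow_succ'] at hg
  exact Finset.mem_mul.1 hg

lemma wordBall_zero (A : Finset G) : wordBall A 0 = {1} := pow_zero A

lemma coe_wordBall (A : Finset G) (n : ℕ) : (wordBall A n : Set G) = (A : Set G) ^ n :=
  Finset.coe_pow A n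

namespace IsSymmGenSet

variable {A : Finset G}

lemma inv_mem_wordBall (hA : IsSymmGenSet A) {g : G} {n : ℕ} (hg : g ∈ wordBall A n) :
    g⁻¹ ∈ wordBall A n := by
  rw [wordBall, ← hA.inv_eq, inv_pow]
  exact Finset.inv_mem_inv hg

lemma wordBall_mono (hA : IsSymmGenSet A) {m n : ℕ} (h : m ≤ n) :
    wordBall A m ⊆ wordBall A n :=
  Finset.pow_subset_pow_right hA.one_mem h

lemma exists_mem_wordBall (hA : IsSymmGenSet A) (g : G) : ∃ n, g ∈ wordBall A n := by
  have hg : g ∈ Subgroup.closure (A : Set G) := by rw [hA.closure_eq]; trivial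
  induction hg using Subgroup.closure_induction with
  | mem x hx => exact ⟨1, mem_wordBall_one.2 hx⟩
  | one => exact ⟨0, by simp [wordBall]⟩
  | mul x y _ _ hx hy =>
    obtain ⟨m, hm⟩ := hx
    obtain ⟨n, hn⟩ := hy
    exact ⟨m + n, mul_mem_wordBall hm hn rfl⟩
  | inv x _ hx =>
    obtain ⟨m, hm⟩ := hx
    exact ⟨m, hA.inv_mem_wordBall hm⟩

end IsSymmGenSet

attribute [irreducible] wordBall

/-- A linear condition on the image of a representation that holds on a bounded power of a
generating set holds on the whole group. -/
lemma apply_eq_zero_of_pow_finrank {K R : Type*} [Field K] [Ring R] [Algebra K R]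
    [FiniteDimensional K R] (ρ : G →* R) (ℓ : R →ₗ[K] K) {A : Finset G}
    (hA : IsSymmGenSet A) {d : ℕ} (hd : Module.finrank K R = d)
    (h : ∀ g ∈ wordBall A d, ℓ (ρ g) = 0) (g : G) : ℓ (ρ g) = 0 := by
  subst hd
  set W := Submodule.span K (ρ '' (A : Set G)) with hW
  have hpow : ∀ n, W ^ n = Submodule.span K (ρ '' (wordBall A n : Set G)) := by
    intro n
    rw [hW, Submodule.span_pow, ← Set.image_pow, coe_wordBall]
  have h1W : 1 ≤ W := by
    rw [Submodule.one_le]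
    exact Submodule.subset_span ⟨1, hA.one_mem, map_one ρ⟩
  obtain ⟨n, hn⟩ := hA.exists_mem_wordBall g
  have hmem : ρ g ∈ W ^ Module.finrank K R := by
    refine Submodule.pow_le_pow_finrank W h1W n ?_
    rw [hpow]
    exact Submodule.subset_span ⟨g, hn, rfl⟩
  rw [hpow] at hmem
  have hle : Submodule.span K (ρ '' (wordBall A (Module.finrank K R) : Set G)) ≤
      LinearMap.ker ℓ := by
    rw [Submodule.span_le]
    rintro _ ⟨a, ha, rfl⟩
    exact h a ha
  exact hle hmem

end Escape

/-! ### Unipotent subgroups and an element with nonzero entries -/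

section Unipotent

variable {F : Type*} [Field F]

def upperUnipotent (s : F) : SpecialLinearGroup (Fin 2) F :=
  ⟨!![1, s; 0, 1], by simp [Matrix.det_fin_two_of]⟩

def lowerUnipotent (s : F) : SpecialLinearGroup (Fin 2) F :=
  ⟨!![1, 0; s, 1], by simp [Matrix.det_fin_two_of]⟩

@[simp] lemma upperUnipotent_zero_zero (s : F) : upperUnipotent s 0 0 = 1 := rfl
@[simp] lemma upperUnipotent_zero_one (s : F) : upperUnipotent s 0 1 = s := rfl
@[simp] lemma upperUnipotent_one_zero (s : F) : upperUnipotent s 1 0 = 0 := rfl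
@[simp] lemma upperUnipotent_one_one (s : F) : upperUnipotent s 1 1 = 1 := rfl
@[simp] lemma lowerUnipotent_zero_zero (s : F) : lowerUnipotent s 0 0 = 1 := rfl
@[simp] lemma lowerUnipotent_zero_one (s : F) : lowerUnipotent s 0 1 = 0 := rfl
@[simp] lemma lowerUnipotent_one_zero (s : F) : lowerUnipotent s 1 0 = s := rfl
@[simp] lemma lowerUnipotent_one_one (s : F) : lowerUnipotent s 1 1 = 1 := rfl

lemma upperUnipotent_mul (s t : F) :
    upperUnipotent s * upperUnipotent t = upperUnipotent (s + t) := by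
  apply sl2_ext <;> rw [sl2_mul_apply] <;> simp [add_comm]

lemma lowerUnipotent_mul (s t : F) :
    lowerUnipotent s * lowerUnipotent t = lowerUnipotent (s + t) := by
  apply sl2_ext <;> rw [sl2_mul_apply] <;> simp

lemma sl2_det (g : SpecialLinearGroup (Fin 2) F) : g 0 0 * g 1 1 - g 0 1 * g 1 0 = 1 := by
  rw [← Matrix.det_fin_two]; exact g.2

variable {K : Type*} [Field K] [Fintype F] [DecidableEq F]

/-- A single bilinear condition `rᵀ g w = 0` holds on a proportion at most `1 / |F|` of the
group. -/
lemma card_bilinear_eq_zero_mul_le (f : F →+* K) {r₀ r₁ w₀ w₁ : K} (hr : r₀ ≠ 0 ∨ r₁ ≠ 0)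
    (hw : w₀ ≠ 0 ∨ w₁ ≠ 0) (S : Finset (SpecialLinearGroup (Fin 2) F))
    (hS : ∀ g ∈ S, r₀ * (f (g 0 0) * w₀ + f (g 0 1) * w₁) +
      r₁ * (f (g 1 0) * w₀ + f (g 1 1) * w₁) = 0) :
    S.card * Fintype.card F ≤ Fintype.card (SpecialLinearGroup (Fin 2) F) := by
  have hnz : ∀ g : SpecialLinearGroup (Fin 2) F, f (g 0 0) * w₀ + f (g 0 1) * w₁ = 0 →
      f (g 1 0) * w₀ + f (g 1 1) * w₁ = 0 → False := by
    intro g h0 h1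
    have hd : f (g 0 0) * f (g 1 1) - f (g 0 1) * f (g 1 0) = 1 := by
      rw [← map_mul, ← map_mul, ← map_sub, sl2_det, map_one]
    have e0 : w₀ = 0 := by linear_combination f (g 1 1) * h0 - f (g 0 1) * h1 - w₀ * hd
    have e1 : w₁ = 0 := by linear_combination f (g 0 0) * h1 - f (g 1 0) * h0 - w₁ * hd
    simp [e0, e1] at hw
  -- If the translates of `S` by a one-parameter subgroup are pairwise disjoint, the bound follows.
  -- If `g` and its translate both satisfied the condition, one coordinate of `g w` would vanish,
  -- then by the condition the other too, contradicting `hnz`.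
  have key : ∀ u : F → SpecialLinearGroup (Fin 2) F, (∀ s t, u s * u t = u (s + t)) →
      (∀ s, s ≠ 0 → ∀ g ∈ S, u s * g ∉ S) →
      S.card * Fintype.card F ≤ Fintype.card (SpecialLinearGroup (Fin 2) F) := by
    intro u hu hd
    rw [← Finset.card_univ (α := F), ← Finset.card_product, ← Finset.card_univ]
    have hu0 : u 0 = 1 := by
      have := hu 0 0
      rw [add_zero] at this
      exact mul_eq_left.1 this
    refine Finset.card_le_card_of_injOn (fun q => u q.2 * q.1)
      (fun _ _ => Finset.mem_coe.2 (Finset.mem_univ _)) ?_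
    rintro ⟨g, s⟩ hg ⟨g', s'⟩ hg' (h : u s * g = u s' * g')
    have hg : g ∈ S := by simpa using hg
    have hg' : g' ∈ S := by simpa using hg'
    have h2 : u (-s' + s) * g = g' := by
      rw [← hu, mul_assoc, h, ← mul_assoc, hu, neg_add_cancel, hu0, one_mul]
    have h3 : -s' + s = 0 := by
      by_contra hne
      exact hd _ hne g hg (h2 ▸ hg')
    have h4 : s = s' := by linear_combination h3
    subst h4
    simpa using h
  by_cases hr0 : r₀ = 0
  · have hr1 : r₁ ≠ 0 := by tauto
    refine key lowerUnipotent lowerUnipotent_mul fun s hs g hg hg' => ?_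
    have e1 := hS _ hg
    have e2 := hS _ hg'
    simp only [sl2_mul_apply, hr0, map_add, map_mul, lowerUnipotent_one_zero,
      lowerUnipotent_one_one, map_one] at e1 e2
    have hfs : f s ≠ 0 := by simpa using hs
    have e3 : (r₁ * f s) * (f (g 0 0) * w₀ + f (g 0 1) * w₁) = 0 := by
      linear_combination e2 - e1
    have e3 := (mul_eq_zero.1 e3).resolve_left (mul_ne_zero hr1 hfs)
    refine hnz g e3 ((mul_eq_zero.1 (?_ : r₁ * _ = 0)).resolve_left hr1)
    linear_combination e1
  · refine key upperUnipotent upperUnipotent_mul fun s hs g hg hg' => ?_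
    have e1 := hS _ hg
    have e2 := hS _ hg'
    simp only [sl2_mul_apply, map_add, map_mul, upperUnipotent_one_zero, upperUnipotent_zero_zero,
      upperUnipotent_one_one, upperUnipotent_zero_one, map_one, map_zero] at e1 e2
    have hfs : f s ≠ 0 := by simpa using hs
    have e3 : (r₀ * f s) * (f (g 1 0) * w₀ + f (g 1 1) * w₁) = 0 := by
      linear_combination e2 - e1
    have e3 := (mul_eq_zero.1 e3).resolve_left (mul_ne_zero hr0 hfs)
    refine hnz g ((mul_eq_zero.1 (?_ : r₀ * _ = 0)).resolve_left hr0) e3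
    linear_combination e1 - r₁ * e3

lemma card_conjMap_apply_eq_zero_mul_le (f : F →+* K) (P : SpecialLinearGroup (Fin 2) K)
    (i j : Fin 2) (S : Finset (SpecialLinearGroup (Fin 2) F))
    (hS : ∀ g ∈ S, conjMap f P g i j = 0) :
    S.card * Fintype.card F ≤ Fintype.card (SpecialLinearGroup (Fin 2) F) := by
  have hP := sl2_det P
  have hP' := sl2_det P⁻¹
  refine card_bilinear_eq_zero_mul_le f (r₀ := P⁻¹ i 0) (r₁ := P⁻¹ i 1) (w₀ := P 0 j)
    (w₁ := P 1 j) ?_ ?_ S fun g hg => ?_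
  · by_contra! h
    fin_cases i <;> simp only [Fin.zero_eta, Fin.mk_one] at h <;> simp [h.1, h.2] at hP'
  · by_contra! h
    fin_cases j <;> simp only [Fin.zero_eta, Fin.mk_one] at h <;> simp [h.1, h.2] at hP
  · have := hS g hg
    rw [conjMap_apply, sl2_mul_apply, sl2_mul_apply, sl2_mul_apply] at this
    simp only [SpecialLinearGroup.map_apply_coe, RingHom.mapMatrix_apply, Matrix.map_apply] at this
    linear_combination this

/-- The third Kronecker power of the conjugated standard representation. -/
def kroneckerCube (f : F →+* K) (P : SpecialLinearGroup (Fin 2) K) :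
    SpecialLinearGroup (Fin 2) F →*
      Matrix ((Fin 2 × Fin 2) × Fin 2) ((Fin 2 × Fin 2) × Fin 2) K where
  toFun g := ((conjMap f P g).1 ⊗ₖ (conjMap f P g).1) ⊗ₖ (conjMap f P g).1
  map_one' := by simp
  map_mul' g h := by
    have h : (conjMap f P (g * h)).1 = (conjMap f P g).1 * (conjMap f P h).1 := by
      rw [map_mul]; rfl
    rw [h, Matrix.mul_kronecker_mul, Matrix.mul_kronecker_mul]

/-- A product of three entries is one entry of the Kronecker cube, so its vanishing is a linear
condition on an algebra of dimension `8 ^ 2 = 64`. If it held on the ball of radius 64 it would hold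
on the whole group. But each entry vanishes on a proportion at most `1 / |F|` of the group, and
three such sets cannot cover it when `|F| > 3`. -/
lemma exists_mem_wordBall_conjMap_ne_zero (f : F →+* K) (P : SpecialLinearGroup (Fin 2) K)
    (hF : 3 < Fintype.card F) {A : Finset (SpecialLinearGroup (Fin 2) F)}
    (hA : IsSymmGenSet A) :
    ∃ g ∈ wordBall A 64, conjMap f P g 0 0 ≠ 0 ∧ conjMap f P g 0 1 ≠ 0 ∧ conjMap f P g 1 0 ≠ 0 := by
  have := Classical.decEq K
  by_contra! hcon
  have hzero : ∀ g, conjMap f P g 0 0 = 0 ∨ conjMap f P g 0 1 = 0 ∨ conjMap f P g 1 0 = 0 := by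
    intro g
    have hfr : Module.finrank K
        (Matrix ((Fin 2 × Fin 2) × Fin 2) ((Fin 2 × Fin 2) × Fin 2) K) = 64 := by
      simp [Module.finrank_matrix]
    have := apply_eq_zero_of_pow_finrank (kroneckerCube f P)
      (Matrix.entryLinearMap K K ((0, 0), 1) ((0, 1), 0)) hA hfr (by
        intro g hg
        simp only [kroneckerCube, MonoidHom.coe_mk, OneHom.coe_mk, Matrix.entryLinearMap_apply,
          Matrix.kroneckerMap_apply, mul_eq_zero]
        by_cases h0 : (conjMap f P g).1 0 0 = 0
        · exact Or.inl (Or.inl h0)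
        by_cases h1 : (conjMap f P g).1 0 1 = 0
        · exact Or.inl (Or.inr h1)
        · exact Or.inr (hcon g hg h0 h1)) g
    simp only [kroneckerCube, MonoidHom.coe_mk, OneHom.coe_mk, Matrix.entryLinearMap_apply,
      Matrix.kroneckerMap_apply, mul_eq_zero] at this
    exact or_assoc.1 this
  have hcard := fun i j => card_conjMap_apply_eq_zero_mul_le f P i j
    (Finset.univ.filter fun g => conjMap f P g i j = 0) (by simp)
  have hcover : (Finset.univ : Finset (SpecialLinearGroup (Fin 2) F)).card ≤
      (Finset.univ.filter fun g => conjMap f P g 0 0 = 0).card +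
      ((Finset.univ.filter fun g => conjMap f P g 0 1 = 0).card +
      (Finset.univ.filter fun g => conjMap f P g 1 0 = 0).card) := by
    refine le_trans (Finset.card_le_card (t := (Finset.univ.filter fun g => conjMap f P g 0 0 = 0) ∪
      ((Finset.univ.filter fun g => conjMap f P g 0 1 = 0) ∪
        (Finset.univ.filter fun g => conjMap f P g 1 0 = 0))) fun g _ => ?_) ?_
    · simpa using hzero g
    · refine (Finset.card_union_le _ _).trans ?_
      gcongr
      exact Finset.card_union_le _ _
  rw [Finset.card_univ] at hcover
  have hpos : 0 < Fintype.card (SpecialLinearGroup (Fin 2) F) := Fintype.card_pos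
  have e1 := hcard 0 0
  have e2 := hcard 0 1
  have e3 := hcard 1 0
  nlinarith

end Unipotent

/-! ### Upper bound for the intersection with a torus -/

section Torus

variable {F : Type*} [Field F] [Fintype F] [DecidableEq F]

/-- Upper bound for the intersection of a slowly growing generating set with a maximal torus. -/
lemma card_commute_cube_le {x : SpecialLinearGroup (Fin 2) F} (hx : x.1.trace ^ 2 ≠ 4)
    (hF : 3 < Fintype.card F) {A : Finset (SpecialLinearGroup (Fin 2) F)}
    (hA : IsSymmGenSet A) :
    ((wordBall A 2).filter fun y => y * x = x * y).card ^ 3 ≤ 512 * (wordBall A 134).card := by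
  have := Classical.decEq (AlgebraicClosure F)
  let f := algebraMap F (AlgebraicClosure F)
  obtain ⟨P, hx₁, hx₂, hx₃⟩ := exists_diagonalizing f x hx
  obtain ⟨g, hg, ha, hb, hc⟩ := exists_mem_wordBall_conjMap_ne_zero f P hF hA
  set T := (wordBall A 2).filter fun y => y * x = x * y with hT
  have hdiag : ∀ y ∈ T, conjMap f P y 0 1 = 0 ∧ conjMap f P y 1 0 = 0 ∧
      conjMap f P y 0 0 ≠ 0 ∧ conjMap f P y 1 1 = (conjMap f P y 0 0)⁻¹ := by
    intro y hy
    obtain ⟨hy₁, hy₂⟩ := offDiag_eq_zero_of_commute hx₁ hx₂ hx₃ (Finset.mem_filter.1 hy).2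
    have h := diag_mul_diag hy₁
    exact ⟨hy₁, hy₂, left_ne_zero_of_mul_eq_one h, eq_inv_of_mul_eq_one_right h⟩
  have hinj : Set.InjOn (fun y => conjMap f P y 0 0) T := by
    intro y hy z hz hyz
    obtain ⟨a1, a2, -, a3⟩ := hdiag y hy
    obtain ⟨b1, b2, -, b3⟩ := hdiag z hz
    apply conjMap_injective f P
    simp only at hyz
    apply sl2_ext
    · exact hyz
    · rw [a1, b1]
    · rw [a2, b2]
    · rw [a3, b3, hyz]
  have key := card_cube_le_of_diagonal ha hb hc (d := conjMap f P g 1 1)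
    (T.image fun y => conjMap f P y 0 0) (by
      intro l hl
      obtain ⟨y, hy, rfl⟩ := Finset.mem_image.1 hl
      exact (hdiag y hy).2.2.1)
    ((wordBall A 134).image fun y => (conjMap f P y 0 0, conjMap f P y 0 1, conjMap f P y 1 0,
      conjMap f P y 1 1)) (by
      intro l hl m hm n hn
      obtain ⟨y, hy, rfl⟩ := Finset.mem_image.1 hl
      obtain ⟨z, hz, rfl⟩ := Finset.mem_image.1 hm
      obtain ⟨w, hw, rfl⟩ := Finset.mem_image.1 hn
      obtain ⟨a1, a2, -, a3⟩ := hdiag y hy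
      obtain ⟨b1, b2, -, b3⟩ := hdiag z hz
      obtain ⟨c1, c2, -, c3⟩ := hdiag w hw
      -- The word lengths add up to `2 + 64 + 2 + 64 + 2 = 134`.
      refine Finset.mem_image.2 ⟨y * g * z * g * w, ?_, ?_⟩
      · have hs := fun v (hv : v ∈ T) => (Finset.mem_filter.1 hv).1
        exact mul_mem_wordBall (mul_mem_wordBall (mul_mem_wordBall (mul_mem_wordBall (hs y hy) hg
          rfl) (hs z hz) rfl) hg rfl) (hs w hw) (by norm_num)
      · simp only [map_mul, sl2_mul_apply, a1, a2, a3, b1, b2, b3, c1, c2, c3, Prod.mk.injEq]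
        refine ⟨?_, ?_, ?_, ?_⟩ <;> ring)
  rw [Finset.card_image_of_injOn hinj] at key
  exact key.trans (Nat.mul_le_mul_left _ Finset.card_image_le)

end Torus

/-! ### Orbit counting for approximate groups -/

section Orbit

variable {G : Type*} [Group G] [DecidableEq G] {A : Finset G}

lemma IsSymmGenSet.inv_mul_mem (hA : IsSymmGenSet A) {a b : G} (ha : a ∈ A) (hb : b ∈ A) :
    a⁻¹ * b ∈ wordBall A 2 :=
  mul_mem_wordBall (hA.inv_mem_wordBall (mem_wordBall_one.2 ha)) (mem_wordBall_one.2 hb) rfl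

lemma IsSymmGenSet.conj_mem (hA : IsSymmGenSet A) {a x : G} (ha : a ∈ A) {k : ℕ}
    (hx : x ∈ wordBall A k) : a * x * a⁻¹ ∈ wordBall A (k + 2) :=
  mul_mem_wordBall (mul_mem_wordBall (mem_wordBall_one.2 ha) hx rfl)
    (hA.inv_mem_wordBall (mem_wordBall_one.2 ha)) (by omega)

/-- The fibres of the orbit map `a ↦ a x a⁻¹` on `A` are no larger than `A² ∩ C(x)`. -/
lemma IsSymmGenSet.card_fiber_conj_le (hA : IsSymmGenSet A) (x r : G) :
    (A.filter fun a => a * x * a⁻¹ = r).card ≤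
      ((wordBall A 2).filter fun y => y * x = x * y).card := by
  rcases (A.filter fun a => a * x * a⁻¹ = r).eq_empty_or_nonempty with h | ⟨b, hb⟩
  · rw [h]; simp
  obtain ⟨hbA, hb⟩ := Finset.mem_filter.1 hb
  refine Finset.card_le_card_of_injOn (fun a => b⁻¹ * a) (fun a ha => ?_)
    fun a _ a' _ h => mul_left_cancel h
  obtain ⟨haA, ha⟩ := Finset.mem_filter.1 ha
  refine Finset.mem_filter.2 ⟨hA.inv_mul_mem hbA haA, ?_⟩
  have h1 : a * x = r * a := by rw [← ha]; group
  have h2 : b⁻¹ * r = x * b⁻¹ := by rw [← hb]; group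
  rw [mul_assoc, h1, ← mul_assoc, h2, mul_assoc]

lemma IsSymmGenSet.card_le_card_commute_mul (hA : IsSymmGenSet A) (x : G) :
    A.card ≤ ((wordBall A 2).filter fun y => y * x = x * y).card *
      (A.image fun a => a * x * a⁻¹).card :=
  Finset.card_le_mul_card_image A _ fun r _ => hA.card_fiber_conj_le x r

end Orbit

/-! ### Counting traces and elements of given trace -/

section Traces

variable {F : Type*} [Field F]

lemma sl2_trace (g : SpecialLinearGroup (Fin 2) F) : g.1.trace = g 0 0 + g 1 1 :=
  Matrix.trace_fin_two g.1

lemma sl2_trace_conj (a x : SpecialLinearGroup (Fin 2) F) :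
    (a * x * a⁻¹).1.trace = x.1.trace := by
  have h : (a * x * a⁻¹).1 = a.1 * x.1 * (a⁻¹).1 := rfl
  have h2 : (a⁻¹).1 * a.1 = 1 := congrArg Subtype.val (inv_mul_cancel a)
  rw [h, Matrix.trace_mul_comm, ← mul_assoc, h2, one_mul]

lemma sl2_inv_zero_zero (g : SpecialLinearGroup (Fin 2) F) : g⁻¹ 0 0 = g 1 1 := by
  rw [SpecialLinearGroup.SL2_inv_expl]; rfl
lemma sl2_inv_zero_one (g : SpecialLinearGroup (Fin 2) F) : g⁻¹ 0 1 = -g 0 1 := by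
  rw [SpecialLinearGroup.SL2_inv_expl]; rfl
lemma sl2_inv_one_zero (g : SpecialLinearGroup (Fin 2) F) : g⁻¹ 1 0 = -g 1 0 := by
  rw [SpecialLinearGroup.SL2_inv_expl]; rfl
lemma sl2_inv_one_one (g : SpecialLinearGroup (Fin 2) F) : g⁻¹ 1 1 = g 0 0 := by
  rw [SpecialLinearGroup.SL2_inv_expl]; rfl

/-- The right-hand side is `-det (x y - y x)`, written in the entries of the matrix `y x - x y`. -/
lemma trace_commutator (x y : SpecialLinearGroup (Fin 2) F) :
    (x * y * x⁻¹ * y⁻¹).1.trace - 2 = (x 1 0 * y 0 1 - x 0 1 * y 1 0) ^ 2 +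
      (x 0 1 * (y 0 0 - y 1 1) - (x 0 0 - x 1 1) * y 0 1) *
      ((x 0 0 - x 1 1) * y 1 0 - x 1 0 * (y 0 0 - y 1 1)) := by
  have hx := sl2_det x
  have hy := sl2_det y
  simp only [sl2_trace, sl2_mul_apply, sl2_inv_zero_zero, sl2_inv_zero_one, sl2_inv_one_zero,
    sl2_inv_one_one]
  linear_combination 2 * (y 0 0 * y 1 1 - y 0 1 * y 1 0) * hx + 2 * hy

variable [DecidableEq F]

/-- If `x` and `y` have no common eigenvector, an element of given trace is determined up to two
possibilities by the traces of its products with `x` and `y`. -/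
lemma card_le_two_mul_of_trace_eq {x y : SpecialLinearGroup (Fin 2) F}
    (hxy : (x * y * x⁻¹ * y⁻¹).1.trace ≠ 2) (t : F) (S : Finset (SpecialLinearGroup (Fin 2) F))
    (hS : ∀ g ∈ S, g.1.trace = t) :
    S.card ≤ 2 * ((S.image fun g => (g * x).1.trace).card *
      (S.image fun g => (g * y).1.trace).card) := by
  rw [← Finset.card_product]
  refine Finset.card_le_mul_card_image_of_maps_to
    (f := fun g => ((g * x).1.trace, (g * y).1.trace)) (fun g hg => Finset.mem_product.2
      ⟨Finset.mem_image.2 ⟨g, hg, rfl⟩, Finset.mem_image.2 ⟨g, hg, rfl⟩⟩) 2 fun q _ => ?_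
  set Φ := S.filter fun g => ((g * x).1.trace, (g * y).1.trace) = q with hΦ
  rcases Φ.eq_empty_or_nonempty with h | ⟨g₀, hg₀⟩
  · rw [h]; simp
  have hq := sub_ne_zero.2 hxy
  rw [trace_commutator] at hq
  set c₀ := x 1 0 * y 0 1 - x 0 1 * y 1 0 with hc₀
  set c₁ := x 0 1 * (y 0 0 - y 1 1) - (x 0 0 - x 1 1) * y 0 1 with hc₁
  set c₂ := (x 0 0 - x 1 1) * y 1 0 - x 1 0 * (y 0 0 - y 1 1) with hc₂
  -- The difference of two elements of `Φ` is orthogonal to `1`, `x` and `y` under the trace form,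
  -- hence is a multiple of the nonzero matrix `y x - x y`, whose entries are `c₀, c₁, c₂, -c₀`.
  have hlin : ∀ g, ∃ l : F, g ∈ Φ → g 0 0 = g₀ 0 0 + l * c₀ ∧ g 0 1 = g₀ 0 1 + l * c₁ ∧
      g 1 0 = g₀ 1 0 + l * c₂ ∧ g 1 1 = g₀ 1 1 - l * c₀ := by
    intro g
    by_cases hg : g ∈ Φ
    swap
    · exact ⟨0, fun h => absurd h hg⟩
    obtain ⟨hgS, hg⟩ := Finset.mem_filter.1 hg
    obtain ⟨hgS₀, hg₀⟩ := Finset.mem_filter.1 hg₀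
    have e0 : g.1.trace = g₀.1.trace := (hS g hgS).trans (hS g₀ hgS₀).symm
    have e1 : (g * x).1.trace = (g₀ * x).1.trace := congrArg Prod.fst (hg.trans hg₀.symm)
    have e2 : (g * y).1.trace = (g₀ * y).1.trace := congrArg Prod.snd (hg.trans hg₀.symm)
    simp only [sl2_trace, sl2_mul_apply] at e0 e1 e2
    have e3 : g 1 1 = g₀ 1 1 - (g 0 0 - g₀ 0 0) := by linear_combination e0
    set m₀ := g 0 0 - g₀ 0 0 with hm₀
    set m₁ := g 0 1 - g₀ 0 1 with hm₁
    set m₂ := g 1 0 - g₀ 1 0 with hm₂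
    have f1 : m₀ * (x 0 0 - x 1 1) + m₁ * x 1 0 + m₂ * x 0 1 = 0 := by
      linear_combination e1 - x 1 1 * e3
    have f2 : m₀ * (y 0 0 - y 1 1) + m₁ * y 1 0 + m₂ * y 0 1 = 0 := by
      linear_combination e2 - y 1 1 * e3
    have k01 : m₀ * c₁ = m₁ * c₀ := by
      rw [hc₀, hc₁]; linear_combination x 0 1 * f2 - y 0 1 * f1
    have k02 : m₀ * c₂ = m₂ * c₀ := by
      rw [hc₀, hc₂]; linear_combination y 1 0 * f1 - x 1 0 * f2
    have k12 : m₁ * c₂ = m₂ * c₁ := by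
      rw [hc₁, hc₂]; linear_combination (x 0 0 - x 1 1) * f2 - (y 0 0 - y 1 1) * f1
    have hm : ∃ l, m₀ = l * c₀ ∧ m₁ = l * c₁ ∧ m₂ = l * c₂ := by
      by_cases h0 : c₀ = 0
      · have h1 : c₁ ≠ 0 := by
          intro h1
          simp [h0, h1] at hq
        refine ⟨m₁ / c₁, ?_, by field_simp, ?_⟩
        · field_simp; exact k01
        · field_simp; exact k12.symm
      · refine ⟨m₀ / c₀, by field_simp, ?_, ?_⟩
        · field_simp; exact k01.symm
        · field_simp; exact k02.symm
    obtain ⟨l, h0, h1, h2⟩ := hm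
    refine ⟨l, fun _ => ⟨?_, ?_, ?_, ?_⟩⟩
    · rw [← h0, hm₀]; ring
    · rw [← h1, hm₁]; ring
    · rw [← h2, hm₂]; ring
    · rw [← h0]; exact e3
  choose l hl using hlin
  have hinj : Set.InjOn l Φ := by
    intro g hg h hh hgh
    obtain ⟨a0, a1, a2, a3⟩ := hl g hg
    obtain ⟨b0, b1, b2, b3⟩ := hl h hh
    rw [hgh] at a0 a1 a2 a3
    exact sl2_ext (a0.trans b0.symm) (a1.trans b1.symm) (a2.trans b2.symm) (a3.trans b3.symm)
  rw [← Finset.card_image_of_injOn hinj]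
  -- On the line through `g₀` in that direction, `det g = 1` is a quadratic equation whose leading
  -- coefficient is nonzero because the commutator has trace different from 2.
  refine card_le_two_of_quadratic _ (c₀ ^ 2 + c₁ * c₂)
    (g₀ 0 0 * c₀ - c₀ * g₀ 1 1 + g₀ 0 1 * c₂ + g₀ 1 0 * c₁) 0 (Or.inl hq) fun r hr => ?_
  obtain ⟨g, hg, rfl⟩ := Finset.mem_image.1 hr
  obtain ⟨a0, a1, a2, a3⟩ := hl g hg
  have hd := sl2_det g
  rw [a0, a1, a2, a3] at hd
  linear_combination sl2_det g₀ - hd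

/-- The set of traces of the elements of `S`. -/
def traces (S : Finset (SpecialLinearGroup (Fin 2) F)) : Finset F := S.image fun g => g.1.trace

lemma mem_traces {S : Finset (SpecialLinearGroup (Fin 2) F)} {t : F} :
    t ∈ traces S ↔ ∃ g ∈ S, g.1.trace = t := Finset.mem_image

variable {A : Finset (SpecialLinearGroup (Fin 2) F)}

/-- Distinct traces give disjoint conjugacy classes, so a slowly growing set has few traces. -/
lemma IsSymmGenSet.card_mul_card_traces_le (hA : IsSymmGenSet A) {τ : ℕ}
    (hτ : ∀ x : SpecialLinearGroup (Fin 2) F, x.1.trace ^ 2 ≠ 4 →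
      ((wordBall A 2).filter fun y => y * x = x * y).card ≤ τ) (k : ℕ) :
    A.card * (traces (wordBall A k)).card ≤ τ * (wordBall A (k + 2)).card + 2 * A.card := by
  -- The bound `τ` concerns only regular elements. The at most two traces with `t ^ 2 = 4` account
  -- for the term `2 * A.card`.
  set R := (traces (wordBall A k)).filter fun t => t ^ 2 ≠ 4 with hR
  have hcard : (traces (wordBall A k)).card ≤ R.card + 2 := by
    have h1 : R.card + ((traces (wordBall A k)).filter fun t => ¬ t ^ 2 ≠ 4).card =
      (traces (wordBall A k)).card := Finset.card_filter_add_card_filter_not _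
    have h2 : ((traces (wordBall A k)).filter fun t => ¬ t ^ 2 ≠ 4).card ≤ 2 := by
      refine card_le_two_of_quadratic _ 1 0 (-4) (Or.inl one_ne_zero) fun t ht => ?_
      have := not_not.1 (Finset.mem_filter.1 ht).2
      linear_combination this
    omega
  have hrep : ∀ t, ∃ g : SpecialLinearGroup (Fin 2) F, t ∈ R →
      g ∈ wordBall A k ∧ g.1.trace = t := by
    intro t
    by_cases ht : t ∈ R
    · obtain ⟨g, hg⟩ := mem_traces.1 (Finset.mem_filter.1 ht).1
      exact ⟨g, fun _ => hg⟩
    · exact ⟨1, fun h => absurd h ht⟩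
  choose s hs using hrep
  have hmain : (A ×ˢ R).card ≤ τ * (wordBall A (k + 2)).card := by
    refine Finset.card_le_mul_card_image_of_maps_to (f := fun q => q.1 * s q.2 * q.1⁻¹) ?_ τ ?_
    · intro q hq
      obtain ⟨h1, h2⟩ := Finset.mem_product.1 hq
      exact hA.conj_mem h1 (hs _ h2).1
    · intro r _
      rcases ((A ×ˢ R).filter fun q => q.1 * s q.2 * q.1⁻¹ = r).eq_empty_or_nonempty with
        h | ⟨⟨a₀, t⟩, h₀⟩
      · rw [h]; simp
      obtain ⟨h₀, h₀r⟩ := Finset.mem_filter.1 h₀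
      have htR : t ∈ R := (Finset.mem_product.1 h₀).2
      have htr : r.1.trace = t := by rw [← h₀r, sl2_trace_conj, (hs t htR).2]
      refine le_trans ?_ ((hA.card_fiber_conj_le (s t) r).trans (hτ (s t) ?_))
      · refine Finset.card_le_card_of_injOn Prod.fst ?_ ?_
        · rintro ⟨a, u⟩ h
          obtain ⟨h, hr⟩ := Finset.mem_filter.1 (Finset.mem_coe.1 h)
          obtain ⟨ha, hu⟩ := Finset.mem_product.1 h
          have : u = t := by rw [← htr, ← hr, sl2_trace_conj, (hs u hu).2]
          subst this
          exact Finset.mem_coe.2 (Finset.mem_filter.2 ⟨ha, hr⟩)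
        · rintro ⟨a, u⟩ h ⟨a', u'⟩ h' (rfl : a = a')
          obtain ⟨h, hr⟩ := Finset.mem_filter.1 (Finset.mem_coe.1 h)
          obtain ⟨h', hr'⟩ := Finset.mem_filter.1 (Finset.mem_coe.1 h')
          have e1 : u = t := by
            rw [← htr, ← hr, sl2_trace_conj, (hs u (Finset.mem_product.1 h).2).2]
          have e2 : u' = t := by
            rw [← htr, ← hr', sl2_trace_conj, (hs u' (Finset.mem_product.1 h').2).2]
          rw [e1, e2]
      · rw [(hs t htR).2]
        exact (Finset.mem_filter.1 htR).2
  rw [Finset.card_product] at hmain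
  calc A.card * (traces (wordBall A k)).card ≤ A.card * (R.card + 2) := by gcongr
    _ = A.card * R.card + 2 * A.card := by ring
    _ ≤ _ := by omega

/-- A symmetric generating set produces a regular semisimple element in boundedly many steps. -/
lemma IsSymmGenSet.exists_trace_sq_ne_four (hA : IsSymmGenSet A) (h2 : (2 : F) ≠ 0) :
    ∃ x ∈ wordBall A 12, x.1.trace ^ 2 ≠ 4 := by
  have hfr : Module.finrank F (Matrix (Fin 2) (Fin 2) F) = 4 := by
    simp [Module.finrank_matrix]
  let ρ : SpecialLinearGroup (Fin 2) F →* Matrix (Fin 2) (Fin 2) F :=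
    { toFun := fun g => g.1, map_one' := rfl, map_mul' := fun _ _ => rfl }
  by_contra! hcon
  obtain ⟨a, ha, ha01⟩ : ∃ a ∈ wordBall A 4, a 0 1 ≠ 0 := by
    by_contra! h
    have := apply_eq_zero_of_pow_finrank ρ (Matrix.entryLinearMap F F 0 1) hA hfr h
      (upperUnipotent 1)
    exact one_ne_zero this
  have hta := hcon a (hA.wordBall_mono (by norm_num) ha)
  -- For fixed `a` the equality is linear in `b`. If it held everywhere, comparing `lowerUnipotent
  -- 1` with `1` would give `2 * a 0 1 = 0`.
  obtain ⟨b, hb, hne⟩ : ∃ b ∈ wordBall A 4, 2 * (a * b).1.trace ≠ a.1.trace * b.1.trace := by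
    by_contra! h
    let ℓ : Matrix (Fin 2) (Fin 2) F →ₗ[F] F :=
      2 • (Matrix.traceLinearMap (Fin 2) F F ∘ₗ LinearMap.mulLeft F a.1) -
        a.1.trace • Matrix.traceLinearMap (Fin 2) F F
    have hℓ : ∀ g, ℓ (ρ g) = 2 * (a * g).1.trace - a.1.trace * g.1.trace := by
      intro g
      simp [ℓ, ρ]
    have h0 := apply_eq_zero_of_pow_finrank ρ ℓ hA hfr (fun g hg => by
      rw [hℓ, h g hg, sub_self])
    have e1 := h0 (lowerUnipotent 1)
    have e2 := h0 1
    rw [hℓ] at e1 e2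
    simp only [sl2_trace, sl2_mul_apply, lowerUnipotent_zero_zero, lowerUnipotent_zero_one,
      lowerUnipotent_one_zero, lowerUnipotent_one_one, mul_one] at e1 e2
    simp at e2
    refine mul_ne_zero h2 ha01 ?_
    linear_combination e1 - e2
  have hab := hcon (a * b) (hA.wordBall_mono (by norm_num) (mul_mem_wordBall ha hb rfl))
  have haab := hcon (a * (a * b)) (mul_mem_wordBall ha (mul_mem_wordBall ha hb rfl) rfl)
  have htb := hcon b (hA.wordBall_mono (by norm_num) hb)
  have hch : (a * (a * b)).1.trace = a.1.trace * (a * b).1.trace - b.1.trace := by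
    have hd := sl2_det a
    simp only [sl2_trace, sl2_mul_apply]
    linear_combination -(b 0 0 + b 1 1) * hd
  rw [hch] at haab
  set α := a.1.trace
  set β := b.1.trace
  set γ := (a * b).1.trace
  -- Here `α`, `β`, `γ` and `α * γ - β` all have square 4. Expanding the last square gives `α * β *
  -- γ = 8`, whence `(2 * γ - α * β) ^ 2 = 16 - 32 + 16 = 0`, against the choice of `b`.
  have h16 : 2 * (α * β * γ - 8) = 0 := by
    linear_combination γ ^ 2 * hta + 4 * hab + htb - haab
  have h16 := (mul_eq_zero.1 h16).resolve_left h2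
  refine hne (sub_eq_zero.1 (pow_eq_zero_iff two_ne_zero |>.1 ?_))
  linear_combination 4 * hab - 4 * h16 + β ^ 2 * hta + 4 * htb

variable [Fintype F]

/-- Upper bound for the number of elements of given trace in a slowly growing generating set. -/
lemma IsSymmGenSet.card_trace_eq_le (hA : IsSymmGenSet A) (hF : 3 < Fintype.card F)
    (h2 : (2 : F) ≠ 0) (t : F) (k : ℕ) :
    ((wordBall A k).filter fun g => g.1.trace = t).card ≤
      2 * (traces (wordBall A (k + 64))).card ^ 2 := by
  obtain ⟨x, hxA, hx⟩ := hA.exists_trace_sq_ne_four h2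
  let f := algebraMap F (AlgebraicClosure F)
  obtain ⟨P, hx₁, hx₂, hx₃⟩ := exists_diagonalizing f x hx
  obtain ⟨y, hyA, -, hb, hc⟩ := exists_mem_wordBall_conjMap_ne_zero f P hF hA
  -- In the eigenbasis of `x` the commutator formula reduces to minus the squared eigenvalue
  -- difference times the product of the off-diagonal entries of `y`, which is nonzero.
  have hxy : (x * y * x⁻¹ * y⁻¹).1.trace ≠ 2 := by
    intro h
    have h3 := trace_commutator (conjMap f P x) (conjMap f P y)
    rw [← map_inv, ← map_inv, ← map_mul, ← map_mul, ← map_mul, trace_conjMap, h, map_ofNat,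
      sub_self, hx₁, hx₂] at h3
    have h4 : (conjMap f P x 0 0 - conjMap f P x 1 1) ^ 2 *
        (conjMap f P y 0 1 * conjMap f P y 1 0) = 0 := by linear_combination h3
    exact mul_ne_zero (pow_ne_zero 2 (sub_ne_zero.2 hx₃)) (mul_ne_zero hb hc) h4
  refine (card_le_two_mul_of_trace_eq hxy t _ fun g hg => (Finset.mem_filter.1 hg).2).trans ?_
  rw [sq]
  gcongr
  · intro u hu
    obtain ⟨g, hg, rfl⟩ := Finset.mem_image.1 hu
    exact mem_traces.2 ⟨g * x, mul_mem_wordBall (Finset.mem_filter.1 hg).1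
      (hA.wordBall_mono (by norm_num) hxA) rfl, rfl⟩
  · intro u hu
    obtain ⟨g, hg, rfl⟩ := Finset.mem_image.1 hu
    exact mem_traces.2 ⟨g * y, mul_mem_wordBall (Finset.mem_filter.1 hg).1 hyA rfl, rfl⟩

end Traces

/-! ### The pivot argument over all conjugates of a torus -/

section Pivot

variable {F : Type*} [Field F] [DecidableEq F] {A : Finset (SpecialLinearGroup (Fin 2) F)}

/-- A torus that meets a bounded power of `A` in a regular element meets `A²` in many elements. -/
lemma IsSymmGenSet.card_le_of_regular_mem (hA : IsSymmGenSet A) {Λ : ℕ}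
    (hΛ : ∀ t : F, ((wordBall A 14).filter fun g => g.1.trace = t).card ≤ Λ)
    {x : SpecialLinearGroup (Fin 2) F} (hx : x ∈ wordBall A 12) :
    A.card ≤ ((wordBall A 2).filter fun y => y * x = x * y).card * Λ := by
  refine (hA.card_le_card_commute_mul x).trans (Nat.mul_le_mul_left _ ?_)
  refine le_trans (Finset.card_le_card fun r hr => ?_) (hΛ x.1.trace)
  obtain ⟨a, ha, rfl⟩ := Finset.mem_image.1 hr
  exact Finset.mem_filter.2 ⟨hA.conj_mem ha hx, sl2_trace_conj a x⟩

lemma exists_ne_one_ne_neg_one {S : Finset (SpecialLinearGroup (Fin 2) F)} (hS : 2 < S.card) :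
    ∃ y ∈ S, y ≠ 1 ∧ y ≠ -1 := by
  by_contra! h
  have : S ⊆ {1, -1} := fun y hy => by
    by_cases h1 : y = 1
    · simp [h1]
    · simp [h y hy h1]
  have := (Finset.card_le_card this).trans Finset.card_le_two
  omega

/-- If one torus meets `A²` in many elements then so do all its conjugates. -/
lemma IsSymmGenSet.card_le_of_conj (hA : IsSymmGenSet A) {Λ : ℕ}
    (hΛ : ∀ t : F, ((wordBall A 14).filter fun g => g.1.trace = t).card ≤ Λ)
    (hcard : 2 * Λ < A.card) {x : SpecialLinearGroup (Fin 2) F} (hx : x.1.trace ^ 2 ≠ 4)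
    (hxA : A.card ≤ ((wordBall A 2).filter fun y => y * x = x * y).card * Λ)
    (h : SpecialLinearGroup (Fin 2) F) :
    A.card ≤ ((wordBall A 2).filter fun y => y * (h * x * h⁻¹) = h * x * h⁻¹ * y).card * Λ := by
  obtain ⟨n, hn⟩ := hA.exists_mem_wordBall h
  induction n generalizing h with
  | zero =>
    rw [wordBall_zero, Finset.mem_singleton] at hn
    subst hn
    simpa using hxA
  | succ n ih =>
    obtain ⟨a, ha, h, hh, rfl⟩ := exists_of_mem_wordBall_succ hn
    have ih := ih h hh
    set z := h * x * h⁻¹ with hz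
    have hzr : z.1.trace ^ 2 ≠ 4 := by rwa [hz, sl2_trace_conj]
    have h3 : 2 < ((wordBall A 2).filter fun y => y * z = z * y).card := by
      by_contra! hle
      have := Nat.mul_le_mul_right Λ hle
      omega
    -- The new torus is reached through a noncentral `y` in `A^2`, not through `h`: its conjugate by
    -- `a` lies in `A^4` however long `h` is, so word lengths do not accumulate.
    obtain ⟨y, hy, hy1, hy2⟩ := exists_ne_one_ne_neg_one h3
    obtain ⟨hyA, hyz⟩ := Finset.mem_filter.1 hy
    have hyr := trace_sq_ne_four_of_commute hzr hyz hy1 hy2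
    have hay : a * y * a⁻¹ ∈ wordBall A 12 := hA.wordBall_mono (by norm_num) (hA.conj_mem ha hyA)
    refine (hA.card_le_of_regular_mem hΛ hay).trans (Nat.mul_le_mul_right _ ?_)
    refine Finset.card_le_card fun w hw => ?_
    obtain ⟨hwA, hw⟩ := Finset.mem_filter.1 hw
    refine Finset.mem_filter.2 ⟨hwA, ?_⟩
    have e : a * h * x * (a * h)⁻¹ = a * z * a⁻¹ := by rw [hz]; group
    rw [e]
    have hcomm : Commute (a * y * a⁻¹) (a * z * a⁻¹) := by
      change a * y * a⁻¹ * (a * z * a⁻¹) = a * z * a⁻¹ * (a * y * a⁻¹)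
      calc a * y * a⁻¹ * (a * z * a⁻¹) = a * (y * z) * a⁻¹ := by group
        _ = a * (z * y) * a⁻¹ := by rw [hyz]
        _ = _ := by group
    exact commute_of_commute_commute (by rwa [sl2_trace_conj]) hcomm hw

variable [Fintype F]

lemma card_centralizer_le {y : SpecialLinearGroup (Fin 2) F} (hy : y.1.trace ^ 2 ≠ 4) :
    (Finset.univ.filter fun z => z * y = y * z).card ≤ 2 * Fintype.card F := by
  refine Finset.card_le_mul_card_image_of_maps_to (f := fun z => z.1.trace)
    (t := Finset.univ) (fun _ _ => Finset.mem_univ _) 2 fun t _ => ?_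
  refine card_le_two_of_commute_of_trace hy t _ fun z hz => ?_
  obtain ⟨hz, hzt⟩ := Finset.mem_filter.1 hz
  exact ⟨(Finset.mem_filter.1 hz).2, hzt⟩

/-- A regular element lies in few conjugates of a given torus, counted by conjugating elements. -/
lemma card_conj_commute_le {x y : SpecialLinearGroup (Fin 2) F} (hx : x.1.trace ^ 2 ≠ 4)
    (hy : y ≠ 1) (hy' : y ≠ -1) :
    (Finset.univ.filter fun h => y * (h * x * h⁻¹) = h * x * h⁻¹ * y).card ≤
      4 * Fintype.card F := by
  set H := Finset.univ.filter fun h => y * (h * x * h⁻¹) = h * x * h⁻¹ * y with hH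
  rcases H.eq_empty_or_nonempty with h | ⟨h₀, hh₀⟩
  · rw [h]; simp
  have hyr : y.1.trace ^ 2 ≠ 4 :=
    trace_sq_ne_four_of_commute (x := h₀ * x * h₀⁻¹) (by rwa [sl2_trace_conj])
      (Finset.mem_filter.1 hh₀).2 hy hy'
  -- The map `h ↦ h⁻¹ y h` has fibres in cosets of the centralizer of `y`, and its image lies in the
  -- torus of `x` with prescribed trace, hence has at most two points.
  have h1 : H.card ≤ 2 * Fintype.card F * (H.image fun h => h⁻¹ * y * h).card := by
    refine Finset.card_le_mul_card_image H _ fun s hs => ?_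
    obtain ⟨b, hb, hbs⟩ := Finset.mem_image.1 hs
    refine le_trans ?_ (card_centralizer_le hyr)
    refine Finset.card_le_card_of_injOn (fun a => a * b⁻¹) (fun a ha => ?_)
      fun a _ a' _ h => mul_right_cancel h
    have ha := (Finset.mem_filter.1 ha).2
    refine Finset.mem_filter.2 ⟨Finset.mem_univ _, ?_⟩
    have e1 : y * a = a * s := by rw [← ha]; group
    have e2 : b⁻¹ * y = s * b⁻¹ := by rw [← hbs]; group
    rw [mul_assoc, e2, ← mul_assoc, ← mul_assoc, e1]
  have h2 : (H.image fun h => h⁻¹ * y * h).card ≤ 2 := by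
    refine card_le_two_of_commute_of_trace hx y.1.trace _ fun s hs => ?_
    obtain ⟨h, hh, rfl⟩ := Finset.mem_image.1 hs
    have hh := (Finset.mem_filter.1 hh).2
    constructor
    · change h⁻¹ * y * h * x = x * (h⁻¹ * y * h)
      calc h⁻¹ * y * h * x = h⁻¹ * (y * (h * x * h⁻¹)) * h := by group
        _ = h⁻¹ * (h * x * h⁻¹ * y) * h := by rw [hh]
        _ = _ := by group
    · have := sl2_trace_conj h⁻¹ y
      rwa [inv_inv] at this
  calc H.card ≤ 2 * Fintype.card F * (H.image fun h => h⁻¹ * y * h).card := h1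
    _ ≤ 2 * Fintype.card F * 2 := by gcongr
    _ = _ := by ring

/-- Since the conjugates of a torus are almost disjoint, a set meeting all of them in many elements
is large. -/
lemma IsSymmGenSet.card_mul_card_le (hA : IsSymmGenSet A) (h2 : (2 : F) ≠ 0) {Λ : ℕ}
    (hΛ : ∀ t : F, ((wordBall A 14).filter fun g => g.1.trace = t).card ≤ Λ)
    (hcard : 4 * Λ ≤ A.card) :
    Fintype.card (SpecialLinearGroup (Fin 2) F) * A.card ≤
      8 * Λ * Fintype.card F * (wordBall A 2).card := by
  obtain ⟨x, hxA, hx⟩ := hA.exists_trace_sq_ne_four h2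
  have hΛ0 : 0 < Λ := by
    refine (Finset.card_pos.2 ⟨x, ?_⟩).trans_le (hΛ x.1.trace)
    exact Finset.mem_filter.2 ⟨hA.wordBall_mono (by norm_num) hxA, rfl⟩
  have hall := hA.card_le_of_conj hΛ (by omega) hx (hA.card_le_of_regular_mem hΛ hxA)
  set B := (wordBall A 2).filter fun y => y ≠ 1 ∧ y ≠ -1 with hB
  -- This is `A.card / (2 * Λ)` rounded up. Each torus contains at least `A.card / Λ - 2` elements
  -- of `B`, and `4 * Λ ≤ A.card` makes this at least `A.card / (2 * Λ)`. Pairs `(h, y)` are then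
  -- counted in two ways.
  set m := (A.card - 1) / (2 * Λ) + 1 with hm
  have hmΛ : A.card ≤ 2 * Λ * m := by
    have := Nat.lt_mul_div_succ (A.card - 1) (b := 2 * Λ) (by omega)
    rw [hm]
    omega
  have key := Finset.card_mul_le_card_mul
    (s := (Finset.univ : Finset (SpecialLinearGroup (Fin 2) F))) (t := B)
    (fun h y => y * (h * x * h⁻¹) = h * x * h⁻¹ * y) (m := m) (n := 4 * Fintype.card F) ?_ ?_
  · rw [Finset.card_univ] at key
    have hBle : B.card ≤ (wordBall A 2).card := Finset.card_filter_le _ _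
    calc Fintype.card (SpecialLinearGroup (Fin 2) F) * A.card
        ≤ Fintype.card (SpecialLinearGroup (Fin 2) F) * (2 * Λ * m) := by gcongr
      _ = 2 * Λ * (Fintype.card (SpecialLinearGroup (Fin 2) F) * m) := by ring
      _ ≤ 2 * Λ * (B.card * (4 * Fintype.card F)) := by gcongr
      _ ≤ 2 * Λ * ((wordBall A 2).card * (4 * Fintype.card F)) := by gcongr
      _ = _ := by ring
  · intro h _
    have h1 := hall h
    set T := (wordBall A 2).filter fun y => y * (h * x * h⁻¹) = h * x * h⁻¹ * y with hT
    set T' := Finset.bipartiteAbove (fun h y => y * (h * x * h⁻¹) = h * x * h⁻¹ * y) B h with hT'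
    have h3 : T.card ≤ T'.card + 2 := by
      have hsub : T ⊆ T' ∪ {1, -1} := by
        intro y hy
        obtain ⟨hyA, hyx⟩ := Finset.mem_filter.1 hy
        by_cases hy1 : y = 1
        · simp [hy1]
        by_cases hy2 : y = -1
        · simp [hy2]
        · exact Finset.mem_union_left _ (Finset.mem_filter.2
            ⟨Finset.mem_filter.2 ⟨hyA, hy1, hy2⟩, hyx⟩)
      exact (Finset.card_le_card hsub).trans ((Finset.card_union_le _ _).trans
        (Nat.add_le_add_left Finset.card_le_two _))
    have h4 : A.card ≤ T'.card * Λ + 2 * Λ := by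
      refine h1.trans ((Nat.mul_le_mul_right _ h3).trans (le_of_eq ?_))
      ring
    rw [hm]
    have h5 : (A.card - 1) / (2 * Λ) < T'.card := by
      rw [Nat.div_lt_iff_lt_mul (by omega)]
      have : T'.card * (2 * Λ) = 2 * (T'.card * Λ) := by ring
      omega
    omega
  · intro y hy
    obtain ⟨-, hy1, hy2⟩ := Finset.mem_filter.1 hy
    exact card_conj_commute_le hx hy1 hy2

end Pivot

/-! ### A second moment sum-product estimate -/

section SumProduct

variable {F : Type*} [Field F] [Fintype F] [DecidableEq F]

/-- The number of representations of `a` as `x * y + z` is `|X| |Z| / |F|` on average, with small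
variance in `(y, a)`. -/
lemma card_mul_card_mul_card_mul_card_compl_le (X Y Z : Finset F) :
    Y.card * (Finset.univ.filter fun a => ∀ x ∈ X, ∀ y ∈ Y, ∀ z ∈ Z, x * y + z ≠ a).card *
      (X.card * Z.card) ≤ Fintype.card F ^ 3 := by
  set q : ℝ := (Fintype.card F : ℝ) with hq
  have hq0 : 0 < q := by rw [hq]; exact_mod_cast Fintype.card_pos
  set D := Finset.univ.filter fun a => ∀ x ∈ X, ∀ y ∈ Y, ∀ z ∈ Z, x * y + z ≠ a with hD
  set P := X ×ˢ Z with hP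
  have hPcard : (P.card : ℝ) = X.card * Z.card := by rw [hP, Finset.card_product]; push_cast; rfl
  let n : F → F → ℝ := fun y a => ∑ u ∈ P, if u.1 * y + u.2 = a then 1 else 0
  have hsum : ∀ y, ∑ a, n y a = P.card := by
    intro y
    simp only [n]
    rw [Finset.sum_comm]
    simp
  have hsq : ∀ y, ∑ a, n y a ^ 2 =
      ∑ u ∈ P, ∑ v ∈ P, if u.1 * y + u.2 = v.1 * y + v.2 then (1 : ℝ) else 0 := by
    intro y
    simp only [n, sq, Finset.sum_mul_sum]
    rw [Finset.sum_comm]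
    refine Finset.sum_congr rfl fun u _ => ?_
    rw [Finset.sum_comm]
    refine Finset.sum_congr rfl fun v _ => ?_
    simp only [mul_ite, mul_one, mul_zero]
    rw [Finset.sum_ite_eq]
    simp
  -- Two distinct lines `a = u.1 * y + u.2` agree for at most one `y`; this near-independence gives
  -- the variance bound.
  have hpair : ∀ u v : F × F,
      ∑ y : F, (if u.1 * y + u.2 = v.1 * y + v.2 then (1 : ℝ) else 0) ≤
        1 + if u = v then q else 0 := by
    intro u v
    rw [Finset.sum_boole]
    by_cases huv : u = v
    · rw [if_pos huv]
      have : ((Finset.univ.filter fun y => u.1 * y + u.2 = v.1 * y + v.2).card : ℝ) ≤ q := by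
        rw [hq]; exact_mod_cast Finset.card_le_univ _
      linarith
    · rw [if_neg huv, add_zero]
      have : (Finset.univ.filter fun y => u.1 * y + u.2 = v.1 * y + v.2).card ≤ 1 := by
        refine Finset.card_le_one.2 fun y hy y' hy' => ?_
        have e1 := (Finset.mem_filter.1 hy).2
        have e2 := (Finset.mem_filter.1 hy').2
        by_contra hne
        have e3 : (u.1 - v.1) * (y - y') = 0 := by linear_combination e1 - e2
        have e4 := (mul_eq_zero.1 e3).resolve_right (sub_ne_zero.2 hne)
        refine huv (Prod.ext (sub_eq_zero.1 e4) ?_)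
        linear_combination e1 - y * e4
      exact_mod_cast this
  have htotal : ∑ y, ∑ a, n y a ^ 2 ≤ (P.card : ℝ) ^ 2 + q * P.card := by
    calc ∑ y, ∑ a, n y a ^ 2
        = ∑ u ∈ P, ∑ v ∈ P, ∑ y : F,
            (if u.1 * y + u.2 = v.1 * y + v.2 then (1 : ℝ) else 0) := by
          simp only [hsq]
          rw [Finset.sum_comm]
          exact Finset.sum_congr rfl fun u _ => Finset.sum_comm
      _ ≤ ∑ u ∈ P, ∑ v ∈ P, (1 + if u = v then q else 0) :=
          Finset.sum_le_sum fun u _ => Finset.sum_le_sum fun v _ => hpair u v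
      _ = (P.card : ℝ) ^ 2 + q * P.card := by
          simp only [Finset.sum_add_distrib, Finset.sum_ite_eq, Finset.sum_const, nsmul_eq_mul,
            mul_one, Finset.sum_ite_mem, Finset.inter_self]
          ring
  have hvar : ∑ y, ∑ a, (n y a - P.card / q) ^ 2 ≤ q * P.card := by
    have e : ∀ y, ∑ a, (n y a - P.card / q) ^ 2 = ∑ a, n y a ^ 2 - P.card ^ 2 / q := by
      intro y
      have : ∀ a, (n y a - P.card / q) ^ 2 =
          n y a ^ 2 - 2 * (P.card / q) * n y a + (P.card / q) ^ 2 := fun a => by ring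
      simp only [this, Finset.sum_add_distrib, Finset.sum_sub_distrib, ← Finset.mul_sum, hsum,
        Finset.sum_const, Finset.card_univ, nsmul_eq_mul, ← hq]
      field_simp
      ring
    simp only [e, Finset.sum_sub_distrib, Finset.sum_const, Finset.card_univ, nsmul_eq_mul, ← hq]
    have : q * ((P.card : ℝ) ^ 2 / q) = P.card ^ 2 := by field_simp
    linarith
  have hlow : (Y.card : ℝ) * (D.card * (P.card / q) ^ 2) ≤
      ∑ y, ∑ a, (n y a - P.card / q) ^ 2 := by
    calc (Y.card : ℝ) * (D.card * (P.card / q) ^ 2)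
        = ∑ y ∈ Y, ∑ a ∈ D, (P.card / q) ^ 2 := by simp
      _ = ∑ y ∈ Y, ∑ a ∈ D, (n y a - P.card / q) ^ 2 := by
          refine Finset.sum_congr rfl fun y hy => Finset.sum_congr rfl fun a ha => ?_
          have : n y a = 0 := Finset.sum_eq_zero fun u hu => by
            obtain ⟨h1, h2⟩ := Finset.mem_product.1 hu
            rw [if_neg ((Finset.mem_filter.1 ha).2 _ h1 y hy _ h2)]
          rw [this]; ring
      _ ≤ ∑ y ∈ Y, ∑ a, (n y a - P.card / q) ^ 2 := Finset.sum_le_sum fun y _ =>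
          Finset.sum_le_sum_of_subset_of_nonneg (Finset.subset_univ _) fun _ _ _ => sq_nonneg _
      _ ≤ _ := Finset.sum_le_sum_of_subset_of_nonneg (Finset.subset_univ _) fun _ _ _ =>
          Finset.sum_nonneg fun _ _ => sq_nonneg _
  have hfin := hlow.trans hvar
  rcases Nat.eq_zero_or_pos P.card with h0 | hpos
  · have : X.card * Z.card = 0 := by rw [← Finset.card_product]; exact h0
    rw [this]; simp
  have hpos' : (0 : ℝ) < P.card := by exact_mod_cast hpos
  have : (Y.card : ℝ) * D.card * (X.card * Z.card) ≤ q ^ 3 := by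
    rw [← hPcard]
    have h1 : (Y.card : ℝ) * (D.card * (P.card / q) ^ 2) =
        (Y.card * D.card * P.card) * (P.card / q ^ 2) := by field_simp
    have h2 : q * P.card = q ^ 3 * (P.card / q ^ 2) := by field_simp
    rw [h1, h2] at hfin
    exact le_of_mul_le_mul_right hfin (by positivity)
  rw [hq] at this
  exact_mod_cast this

lemma exists_add_eq_of_card_lt {E : Finset F} (hE : Fintype.card F < 2 * E.card) (a : F) :
    ∃ u ∈ E, ∃ v ∈ E, u + v = a := by
  by_contra! h
  have hdis : Disjoint E (E.image fun v => a - v) := by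
    rw [Finset.disjoint_left]
    intro u hu hu'
    obtain ⟨v, hv, hvu⟩ := Finset.mem_image.1 hu'
    exact h u hu v hv (by rw [← hvu]; ring)
  have h1 := Finset.card_le_univ (E ∪ E.image fun v => a - v)
  rw [Finset.card_union_of_disjoint hdis,
    Finset.card_image_of_injective _ sub_right_injective] at h1
  omega

/-- By the variance bound, fewer than half of all field elements are not of the form `x * y + z`. A
set containing more than half of the field meets its reflection `a - E`, so two summands suffice. -/
lemma exists_sum_of_products {X Y : Finset F}
    (h : 2 * Fintype.card F ^ 2 < X.card ^ 2 * Y.card) (a : F) :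
    ∃ x ∈ X, ∃ y ∈ Y, ∃ z ∈ X, ∃ x' ∈ X, ∃ y' ∈ Y, ∃ z' ∈ X,
      (x * y + z) + (x' * y' + z') = a := by
  set E := Finset.univ.filter fun a => ¬ ∀ x ∈ X, ∀ y ∈ Y, ∀ z ∈ X, x * y + z ≠ a with hE
  have h1 := card_mul_card_mul_card_mul_card_compl_le X Y X
  have h2 : (Finset.univ.filter fun a => ∀ x ∈ X, ∀ y ∈ Y, ∀ z ∈ X, x * y + z ≠ a).card +
      E.card = Fintype.card F := by
    rw [hE, Finset.card_filter_add_card_filter_not, Finset.card_univ]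
  set d := (Finset.univ.filter fun a => ∀ x ∈ X, ∀ y ∈ Y, ∀ z ∈ X, x * y + z ≠ a).card
  have hEc : Fintype.card F < 2 * E.card := by
    by_contra! hle
    have hd : Fintype.card F ≤ 2 * d := by omega
    have hq : 0 < Fintype.card F := Fintype.card_pos
    have h3 : Fintype.card F * (X.card ^ 2 * Y.card) ≤ 2 * Fintype.card F ^ 3 := by
      calc Fintype.card F * (X.card ^ 2 * Y.card) ≤ 2 * d * (X.card ^ 2 * Y.card) := by gcongr
        _ = 2 * (Y.card * d * (X.card * X.card)) := by ring
        _ ≤ _ := by omega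
    have h4 : Fintype.card F * (2 * Fintype.card F ^ 2) <
        Fintype.card F * (X.card ^ 2 * Y.card) := by gcongr
    have h5 : Fintype.card F * (2 * Fintype.card F ^ 2) = 2 * Fintype.card F ^ 3 := by ring
    omega
  obtain ⟨u, hu, v, hv, huv⟩ := exists_add_eq_of_card_lt hEc a
  have hu := (Finset.mem_filter.1 hu).2
  have hv := (Finset.mem_filter.1 hv).2
  push Not at hu hv
  obtain ⟨x, hx, y, hy, z, hz, rfl⟩ := hu
  obtain ⟨x', hx', y', hy', z', hz', rfl⟩ := hv
  exact ⟨x, hx, y, hy, z, hz, x', hx', y', hy', z', hz', huv⟩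

end SumProduct

/-! ### Sets with more than about `q^(8/3)` elements fill the group -/

lemma Finset.exists_card_le_card_fiber_mul {α β : Type*} [Fintype β] [Nonempty β] [DecidableEq β]
    (s : Finset α) (f : α → β) :
    ∃ b, s.card ≤ (s.filter fun a => f a = b).card * Fintype.card β := by
  obtain ⟨b, -, hb⟩ := Finset.exists_max_image (Finset.univ : Finset β)
    (fun b => (s.filter fun a => f a = b).card) Finset.univ_nonempty
  exact ⟨b, Finset.card_le_mul_card_image_of_maps_to (f := f) (t := Finset.univ)
    (fun _ _ => Finset.mem_univ _) _ fun b' hb' => hb b' hb'⟩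

lemma sl2_mul_upperUnipotent_mul_inv {F : Type*} [Field F]
    {c : SpecialLinearGroup (Fin 2) F} (hc : c 1 0 = 0) (s : F) :
    c * upperUnipotent s * c⁻¹ = upperUnipotent (s * c 0 0 ^ 2) := by
  have hd := sl2_det c
  rw [hc, mul_zero, sub_zero] at hd
  apply sl2_ext <;> simp only [sl2_mul_apply, sl2_inv_zero_zero, sl2_inv_one_zero,
    sl2_inv_zero_one, sl2_inv_one_one, upperUnipotent_zero_zero, upperUnipotent_zero_one,
    upperUnipotent_one_zero, upperUnipotent_one_one, hc]
  · linear_combination hd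
  · ring
  · ring
  · linear_combination hd

section Large

variable {F : Type*} [Field F] [Fintype F] [DecidableEq F]
  {A : Finset (SpecialLinearGroup (Fin 2) F)}

/-- A large set has a large quotient set inside the upper triangular subgroup. -/
lemma IsSymmGenSet.exists_upperTriangular (hA : IsSymmGenSet A) :
    ∃ C ⊆ wordBall A 2, (∀ c ∈ C, c 1 0 = 0) ∧ A.card ≤ C.card * (Fintype.card F + 1) := by
  -- `Option F` is the projective line with `none` at infinity. Two matrices have proportional
  -- bottom rows exactly when they lie in the same right coset of the upper triangular subgroup.
  obtain ⟨b, hb⟩ := A.exists_card_le_card_fiber_mul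
    (fun g => if g 1 0 = 0 then none else some (g 1 1 / g 1 0) :
      SpecialLinearGroup (Fin 2) F → Option F)
  rw [Fintype.card_option] at hb
  set S := A.filter fun g => (if g 1 0 = 0 then none else some (g 1 1 / g 1 0)) = b with hS
  obtain ⟨g₀, hg₀⟩ : S.Nonempty := by
    rw [← Finset.card_pos]
    have : 0 < A.card := Finset.card_pos.2 ⟨1, hA.one_mem⟩
    by_contra h
    have : S.card = 0 := by omega
    rw [this] at hb
    omega
  refine ⟨S.image fun g => g * g₀⁻¹, ?_, ?_, ?_⟩
  · intro c hc
    obtain ⟨g, hg, rfl⟩ := Finset.mem_image.1 hc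
    exact mul_mem_wordBall (mem_wordBall_one.2 (Finset.mem_filter.1 hg).1)
      (hA.inv_mem_wordBall (mem_wordBall_one.2 (Finset.mem_filter.1 hg₀).1)) rfl
  · intro c hc
    obtain ⟨g, hg, rfl⟩ := Finset.mem_image.1 hc
    have e := (Finset.mem_filter.1 hg).2.trans (Finset.mem_filter.1 hg₀).2.symm
    rw [sl2_mul_apply, sl2_inv_zero_zero, sl2_inv_one_zero]
    by_cases h1 : g 1 0 = 0 <;> by_cases h2 : g₀ 1 0 = 0
    · rw [h1, h2]; ring
    · simp [h1, h2] at e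
    · simp [h1, h2] at e
    · rw [if_neg h1, if_neg h2, Option.some_inj, div_eq_div_iff h1 h2] at e
      linear_combination -e
  · rwa [Finset.card_image_of_injective _ (mul_left_injective _)]

/-- A large symmetric generating set covers the upper unipotent subgroup in boundedly many
steps. -/
lemma IsSymmGenSet.upperUnipotent_mem_wordBall (hA : IsSymmGenSet A)
    (hcard : 32 * Fintype.card F ^ 8 < A.card ^ 3) (s : F) :
    upperUnipotent s ∈ wordBall A 24 := by
  set q := Fintype.card F with hq
  have hq1 : 1 ≤ q := Fintype.card_pos
  obtain ⟨C, hCA, hC, hCcard⟩ := hA.exists_upperTriangular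
  rw [← hq] at hCcard
  have hdet : ∀ c ∈ C, c 0 0 * c 1 1 = 1 := by
    intro c hc
    have := sl2_det c
    rwa [hC c hc, mul_zero, sub_zero] at this
  have hdiag : ∀ c ∈ C, ∀ c' ∈ C, c 0 0 = c' 0 0 → c 1 1 = c' 1 1 := by
    intro c hc c' hc' h
    have h1 := hdet c hc
    have h2 := hdet c' hc'
    rw [← h] at h2
    exact mul_left_cancel₀ (left_ne_zero_of_mul_eq_one h1) (h1.trans h2.symm)
  -- Conjugation by `c` scales a unipotent parameter by `c 0 0 ^ 2`, so `x * y + z` is reached with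
  -- length `(2 + 4 + 2) + 4 = 12`, and a sum of two such terms with 24.
  set X := Finset.univ.filter fun s : F => upperUnipotent s ∈ wordBall A 4 with hX
  set Y := (C.image fun c => c 0 0).image fun r => r ^ 2 with hY
  have hXcard : C.card ≤ X.card * q := by
    obtain ⟨r, hr⟩ := C.exists_card_le_card_fiber_mul (fun c => c 0 0)
    refine hr.trans (Nat.mul_le_mul_right _ ?_)
    rcases (C.filter fun c => c 0 0 = r).eq_empty_or_nonempty with h | ⟨c₀, hc₀⟩
    · rw [h]; simp
    obtain ⟨hc₀C, hc₀⟩ := Finset.mem_filter.1 hc₀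
    have hform : ∀ c ∈ C, c 0 0 = r → c * c₀⁻¹ = upperUnipotent ((c * c₀⁻¹) 0 1) := by
      intro c hc hcr
      have h1 := hdiag c hc c₀ hc₀C (hcr.trans hc₀.symm)
      have h2 := hdet c hc
      apply sl2_ext <;> simp only [sl2_mul_apply, sl2_inv_zero_zero, sl2_inv_one_zero,
        sl2_inv_zero_one, sl2_inv_one_one, upperUnipotent_zero_zero, upperUnipotent_zero_one,
        upperUnipotent_one_zero, upperUnipotent_one_one, hC c hc, hC c₀ hc₀C, ← h1, hc₀, ← hcr]
      · linear_combination h2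
      · ring
      · linear_combination h2
    refine Finset.card_le_card_of_injOn (fun c => (c * c₀⁻¹) 0 1) ?_ ?_
    · intro c hc
      obtain ⟨hcC, hc⟩ := Finset.mem_filter.1 (Finset.mem_coe.1 hc)
      refine Finset.mem_coe.2 (Finset.mem_filter.2 ⟨Finset.mem_univ _, ?_⟩)
      rw [← hform c hcC hc]
      exact mul_mem_wordBall (hCA hcC) (hA.inv_mem_wordBall (hCA hc₀C)) rfl
    · intro c hc c' hc' h
      obtain ⟨hcC, hc⟩ := Finset.mem_filter.1 (Finset.mem_coe.1 hc)
      obtain ⟨hcC', hc'⟩ := Finset.mem_filter.1 (Finset.mem_coe.1 hc')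
      simp only at h
      have h1 := hform c hcC hc
      rw [h, ← hform c' hcC' hc'] at h1
      exact mul_right_cancel h1
  have hYcard : C.card ≤ 2 * q * Y.card := by
    have h1 : C.card ≤ q * (C.image fun c => c 0 0).card := by
      refine Finset.card_le_mul_card_image C q fun r _ => ?_
      rw [hq, ← Finset.card_univ]
      refine Finset.card_le_card_of_injOn (fun c => c 0 1)
        (fun _ _ => Finset.mem_coe.2 (Finset.mem_univ _)) ?_
      intro c hc c' hc' h
      obtain ⟨hcC, hc⟩ := Finset.mem_filter.1 (Finset.mem_coe.1 hc)
      obtain ⟨hcC', hc'⟩ := Finset.mem_filter.1 (Finset.mem_coe.1 hc')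
      have hcc : c 0 0 = c' 0 0 := hc.trans hc'.symm
      exact sl2_ext hcc h ((hC c hcC).trans (hC c' hcC').symm) (hdiag c hcC c' hcC' hcc)
    have h2 : (C.image fun c => c 0 0).card ≤ 2 * Y.card := by
      refine Finset.card_le_mul_card_image _ 2 fun b _ => ?_
      refine card_le_two_of_quadratic _ 1 0 (-b) (Or.inl one_ne_zero) fun y hy => ?_
      have := (Finset.mem_filter.1 hy).2
      linear_combination this
    calc C.card ≤ q * (C.image fun c => c 0 0).card := h1
      _ ≤ q * (2 * Y.card) := by gcongr
      _ = _ := by ring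
  -- As `A.card ≤ 2 * q * C.card`, the hypothesis gives `C.card ^ 3 > 4 * q ^ 5`, and `X.card ^ 2 *
  -- Y.card` is at least `C.card ^ 3 / (2 * q ^ 3)`.
  have hXY : 2 * q ^ 2 < X.card ^ 2 * Y.card := by
    by_contra! hle
    have h1 : A.card ≤ 2 * q * C.card := by nlinarith
    have h2 : C.card ^ 3 ≤ 4 * q ^ 5 := by
      calc C.card ^ 3 = C.card * C.card * C.card := by ring
        _ ≤ (X.card * q) * (X.card * q) * (2 * q * Y.card) := by gcongr
        _ = 2 * q ^ 3 * (X.card ^ 2 * Y.card) := by ring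
        _ ≤ 2 * q ^ 3 * (2 * q ^ 2) := by gcongr
        _ = 4 * q ^ 5 := by ring
    have h3 : A.card ^ 3 ≤ 32 * q ^ 8 := by
      calc A.card ^ 3 ≤ (2 * q * C.card) ^ 3 := by gcongr
        _ = 8 * q ^ 3 * C.card ^ 3 := by ring
        _ ≤ 8 * q ^ 3 * (4 * q ^ 5) := by gcongr
        _ = 32 * q ^ 8 := by ring
    omega
  have hmem : ∀ x ∈ X, ∀ y ∈ Y, ∀ z ∈ X, upperUnipotent (x * y + z) ∈ wordBall A 12 := by
    intro x hx y hy z hz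
    obtain ⟨r, hr, rfl⟩ := Finset.mem_image.1 hy
    obtain ⟨c, hc, rfl⟩ := Finset.mem_image.1 hr
    have hx := (Finset.mem_filter.1 hx).2
    have hz := (Finset.mem_filter.1 hz).2
    rw [← upperUnipotent_mul, ← sl2_mul_upperUnipotent_mul_inv (hC c hc)]
    exact mul_mem_wordBall (mul_mem_wordBall (mul_mem_wordBall (hCA hc) hx rfl)
      (hA.inv_mem_wordBall (hCA hc)) rfl) hz rfl
  obtain ⟨x, hx, y, hy, z, hz, x', hx', y', hy', z', hz', rfl⟩ := exists_sum_of_products hXY s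
  rw [← upperUnipotent_mul]
  exact mul_mem_wordBall (hmem x hx y hy z hz) (hmem x' hx' y' hy' z' hz') rfl

/-- A large symmetric generating set covers the group in boundedly many steps. -/
lemma IsSymmGenSet.wordBall_eq_univ_of_large (hA : IsSymmGenSet A)
    (hcard : 32 * Fintype.card F ^ 8 < A.card ^ 3) : wordBall A 156 = Finset.univ := by
  have hU := hA.upperUnipotent_mem_wordBall hcard
  have hfr : Module.finrank F (Matrix (Fin 2) (Fin 2) F) = 4 := by
    simp [Module.finrank_matrix]
  let ρ : SpecialLinearGroup (Fin 2) F →* Matrix (Fin 2) (Fin 2) F :=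
    { toFun := fun g => g.1, map_one' := rfl, map_mul' := fun _ _ => rfl }
  obtain ⟨g, hg, hg10⟩ : ∃ g ∈ wordBall A 4, g 1 0 ≠ 0 := by
    by_contra! h
    have := apply_eq_zero_of_pow_finrank ρ (Matrix.entryLinearMap F F 1 0) hA hfr h
      (lowerUnipotent 1)
    exact one_ne_zero this
  set c := g 1 0 with hc
  -- The double coset of `g` under the upper unipotents consists of all matrices with the same lower
  -- left entry; its length is `24 + 4 + 24`.
  have hUgU : ∀ h : SpecialLinearGroup (Fin 2) F, h 1 0 = c → h ∈ wordBall A 52 := by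
    intro h hh
    have e : h = upperUnipotent ((h 0 0 - g 0 0) / c) * g *
        upperUnipotent ((h 1 1 - g 1 1) / c) := by
      have d1 := sl2_det h
      have d2 := sl2_det g
      rw [← hc] at d2
      rw [hh] at d1
      apply sl2_ext <;> simp only [sl2_mul_apply, upperUnipotent_zero_zero,
        upperUnipotent_zero_one, upperUnipotent_one_zero, upperUnipotent_one_one, ← hc, hh]
      · field_simp; ring
      · field_simp; linear_combination d2 - d1
      · ring
      · field_simp; ring
    rw [e]
    exact mul_mem_wordBall (mul_mem_wordBall (hU _) hg rfl) (hU _) rfl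
  have hne : ∀ h : SpecialLinearGroup (Fin 2) F, h 1 0 ≠ 0 → h ∈ wordBall A 104 := by
    intro h hh
    -- The upper left entry of `k` is chosen so that `k⁻¹ * h` also has lower left entry `c`.
    let k : SpecialLinearGroup (Fin 2) F := ⟨!![c * (1 + h 0 0) / h 1 0, -c⁻¹; c, 0], by
      rw [Matrix.det_fin_two_of]; field_simp; ring⟩
    have hk : k ∈ wordBall A 52 := hUgU k rfl
    have hkh : k⁻¹ * h ∈ wordBall A 52 := by
      apply hUgU
      rw [sl2_mul_apply, sl2_inv_one_zero, sl2_inv_one_one]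
      change -c * h 0 0 + c * (1 + h 0 0) / h 1 0 * h 1 0 = c
      field_simp
      ring
    have := mul_mem_wordBall hk hkh (k := 104) rfl
    rwa [mul_inv_cancel_left] at this
  refine Finset.eq_univ_of_forall fun h => ?_
  by_cases hh : h 1 0 = 0
  · have hd := sl2_det h
    rw [hh, mul_zero, sub_zero] at hd
    have hgh : g⁻¹ * h ∈ wordBall A 104 := by
      apply hne
      rw [sl2_mul_apply, sl2_inv_one_zero, hh, mul_zero, add_zero]
      exact mul_ne_zero (neg_ne_zero.2 hg10) (left_ne_zero_of_mul_eq_one hd)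
    have := mul_mem_wordBall hg hgh rfl
    rw [mul_inv_cancel_left] at this
    exact hA.wordBall_mono (by norm_num) this
  · exact hA.wordBall_mono (by norm_num) (hne h hh)

end Large

/-! ### The growth theorem -/

lemma growth_arith_real {n w t r q : ℝ} (hn : 0 < n) (hnw : n ≤ w) (ht : 1 ≤ t) (hr : 0 ≤ r)
    (ht3 : t ^ 3 ≤ 512 * w) (hrt : n * r ≤ t * w + 2 * n) (hnq : n ^ 3 ≤ 32 * q ^ 8)
    (h : n ≤ 8 * r ^ 2 ∨ q ^ 2 * n ≤ 32 * r ^ 2 * w) : n ^ 45 ≤ 2 ^ 187 * w ^ 44 := by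
  -- `K` is the growth factor; `t` bounds torus intersections, `r` counts traces and `q` is the
  -- field size. The bounds give `r ≤ 3 * t * K` with `t ^ 3 ≤ 512 * K * n`, so `r` is about
  -- `n^(1/3)` up to powers of `K`.
  obtain ⟨K, rfl⟩ : ∃ K, w = K * n := ⟨w / n, by field_simp⟩
  have hK1 : 1 ≤ K := by
    refine le_of_mul_le_mul_right ?_ hn
    linarith
  have hrK : r ≤ 3 * (t * K) := by
    have h4 : n * r ≤ n * (t * K + 2) := by linarith
    have h5 := le_of_mul_le_mul_left h4 hn
    have h6 : 1 ≤ t * K := by nlinarith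
    linarith
  have hr6 : r ^ 6 ≤ 2 ^ 28 * K ^ 8 * n ^ 2 := by
    calc r ^ 6 ≤ (3 * (t * K)) ^ 6 := by gcongr
      _ = 729 * K ^ 6 * (t ^ 3) ^ 2 := by ring
      _ ≤ 729 * K ^ 6 * (512 * (K * n)) ^ 2 := by gcongr
      _ = 191102976 * (K ^ 8 * n ^ 2) := by ring
      _ ≤ 2 ^ 28 * (K ^ 8 * n ^ 2) := by gcongr; norm_num
      _ = _ := by ring
  have hfinal : n ≤ 2 ^ 187 * K ^ 44 := by
    rcases h with h | h
    · have h4 : n ^ 2 * n ≤ n ^ 2 * (2 ^ 37 * K ^ 8) := by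
        calc n ^ 2 * n = n ^ 3 := by ring
          _ ≤ (8 * r ^ 2) ^ 3 := by gcongr
          _ = 512 * r ^ 6 := by ring
          _ ≤ 512 * (2 ^ 28 * K ^ 8 * n ^ 2) := by gcongr
          _ = _ := by ring
      calc n ≤ 2 ^ 37 * K ^ 8 := le_of_mul_le_mul_left h4 (by positivity)
        _ ≤ 2 ^ 187 * K ^ 44 := by gcongr <;> norm_num
    · have h3 : q ^ 2 ≤ 32 * r ^ 2 * K := by
        refine le_of_mul_le_mul_right ?_ hn
        linarith
      have h4 : q ^ 6 ≤ 2 ^ 43 * K ^ 11 * n ^ 2 := by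
        calc q ^ 6 = (q ^ 2) ^ 3 := by ring
          _ ≤ (32 * r ^ 2 * K) ^ 3 := by gcongr
          _ = 2 ^ 15 * K ^ 3 * r ^ 6 := by ring
          _ ≤ 2 ^ 15 * K ^ 3 * (2 ^ 28 * K ^ 8 * n ^ 2) := by gcongr
          _ = _ := by ring
      -- The gap between `q^(8/3)` and `q^3` is spent here: `n ^ 9` is at most a multiple of `q ^
      -- 24`, which is bounded by `n ^ 8` times a power of `K`. The exponents are `187 = 15 + 4 *
      -- 43` and `44 = 4 * 11`.
      have h6 : n ^ 8 * n ≤ n ^ 8 * (2 ^ 187 * K ^ 44) := by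
        calc n ^ 8 * n = (n ^ 3) ^ 3 := by ring
          _ ≤ (32 * q ^ 8) ^ 3 := by gcongr
          _ = 2 ^ 15 * (q ^ 6) ^ 4 := by ring
          _ ≤ 2 ^ 15 * (2 ^ 43 * K ^ 11 * n ^ 2) ^ 4 := by gcongr
          _ = _ := by ring
      exact le_of_mul_le_mul_left h6 (by positivity)
  calc n ^ 45 = n ^ 44 * n := by ring
    _ ≤ n ^ 44 * (2 ^ 187 * K ^ 44) := by gcongr
    _ = 2 ^ 187 * (K * n) ^ 44 := by ring

lemma growth_arith {n w t r q : ℕ} (hn : 0 < n) (hnw : n ≤ w) (ht : 1 ≤ t)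
    (ht3 : t ^ 3 ≤ 512 * w) (hrt : n * r ≤ t * w + 2 * n) (hnq : n ^ 3 ≤ 32 * q ^ 8)
    (h : n ≤ 8 * r ^ 2 ∨ q ^ 2 * n ≤ 32 * r ^ 2 * w) : n ^ 45 ≤ 2 ^ 187 * w ^ 44 := by
  have := growth_arith_real (n := n) (w := w) (t := t) (r := r) (q := q) (by exact_mod_cast hn)
    (by exact_mod_cast hnw) (by exact_mod_cast ht) r.cast_nonneg
    (by exact_mod_cast ht3) (by exact_mod_cast hrt) (by exact_mod_cast hnq)
    (by exact_mod_cast h)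
  exact_mod_cast this

section Growth

variable {F : Type*} [Field F] [Fintype F] [DecidableEq F]

lemma card_sl2_ge : (Fintype.card F - 1) * Fintype.card F ^ 2 ≤
    Fintype.card (SpecialLinearGroup (Fin 2) F) := by
  have hdet : ∀ t : Fˣ × F × F,
      (!![(t.1 : F), t.2.1; t.2.2, (1 + t.2.1 * t.2.2) / t.1]).det = 1 := by
    intro t
    have := t.1.ne_zero
    rw [Matrix.det_fin_two_of]
    field_simp
    ring
  have h := Fintype.card_le_of_injective
    (fun t : Fˣ × F × F => (⟨_, hdet t⟩ : SpecialLinearGroup (Fin 2) F)) (by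
      rintro ⟨a, b, c⟩ ⟨a', b', c'⟩ e
      have e := congrArg Subtype.val e
      have e1 : (a : F) = a' := congrFun (congrFun e 0) 0
      have e2 : b = b' := congrFun (congrFun e 0) 1
      have e3 : c = c' := congrFun (congrFun e 1) 0
      rw [Units.ext e1, e2, e3])
  rw [Fintype.card_prod, Fintype.card_prod, Fintype.card_units] at h
  rwa [sq]

lemma card_sl2_le : Fintype.card (SpecialLinearGroup (Fin 2) F) ≤ Fintype.card F ^ 4 := by
  have h := Fintype.card_le_of_injective
    (fun g : SpecialLinearGroup (Fin 2) F => (g 0 0, g 0 1, g 1 0, g 1 1)) (by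
      intro g h e
      simp only [Prod.mk.injEq] at e
      exact sl2_ext e.1 e.2.1 e.2.2.1 e.2.2.2)
  simp only [Fintype.card_prod] at h
  refine h.trans (le_of_eq (by ring))

variable {A : Finset (SpecialLinearGroup (Fin 2) F)}

/-- Growth: a symmetric generating set either covers the group in boundedly many steps, or grows by
a power of its size. -/
lemma IsSymmGenSet.growth (hA : IsSymmGenSet A) (hF : 3 < Fintype.card F) (h2 : (2 : F) ≠ 0)
    (huniv : wordBall A 156 ≠ Finset.univ) :
    A.card ^ 45 ≤ 2 ^ 187 * (wordBall A 156).card ^ 44 := by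
  set W := (wordBall A 156).card with hW
  have hle : ∀ k ≤ 156, (wordBall A k).card ≤ W := fun k hk =>
    Finset.card_le_card (hA.wordBall_mono hk)
  have hNpos : 0 < A.card := Finset.card_pos.2 ⟨1, hA.one_mem⟩
  have hNW : A.card ≤ W := by
    refine Finset.card_le_card fun a ha => ?_
    exact hA.wordBall_mono (by norm_num) (mem_wordBall_one.2 ha)
  -- `τ` is the integer cube root of `512 * W`, a bound uniform over all regular elements.
  obtain ⟨τ, hτ, hτ3, hτ1⟩ : ∃ τ : ℕ, (∀ x : SpecialLinearGroup (Fin 2) F, x.1.trace ^ 2 ≠ 4 →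
      ((wordBall A 2).filter fun y => y * x = x * y).card ≤ τ) ∧ τ ^ 3 ≤ 512 * W ∧ 1 ≤ τ := by
    refine ⟨Nat.findGreatest (fun t => t ^ 3 ≤ 512 * W) (512 * W), fun x hx => ?_, ?_, ?_⟩
    · have h3 := (card_commute_cube_le hx hF hA).trans
        (Nat.mul_le_mul_left 512 (hle 134 (by norm_num)))
      exact Nat.le_findGreatest ((Nat.le_self_pow (by norm_num) _).trans h3) h3
    · exact Nat.findGreatest_spec (P := fun t => t ^ 3 ≤ 512 * W) (Nat.zero_le _) (by simp)
    · exact Nat.le_findGreatest (by omega) (by omega)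
  -- The radius is `78 = 14 + 64`: conjugates of elements of `A^12` lie in `A^14`, and the trace
  -- coordinates cost another 64.
  set R := (traces (wordBall A 78)).card with hR
  have hRle : A.card * R ≤ τ * W + 2 * A.card :=
    (hA.card_mul_card_traces_le hτ 78).trans
      (Nat.add_le_add_right (Nat.mul_le_mul_left _ (hle 80 (by norm_num))) _)
  have hΛ : ∀ t : F, ((wordBall A 14).filter fun g => g.1.trace = t).card ≤ 2 * R ^ 2 :=
    fun t => hA.card_trace_eq_le hF h2 t 14
  have hsmall : A.card ^ 3 ≤ 32 * Fintype.card F ^ 8 := by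
    by_contra! h
    exact huniv (hA.wordBall_eq_univ_of_large h)
  set q := Fintype.card F with hq
  have hpivot : 4 * (2 * R ^ 2) ≤ A.card → q ^ 2 * A.card ≤ 32 * R ^ 2 * W := by
    intro h
    have h3 := hA.card_mul_card_le h2 hΛ h
    have h4 := card_sl2_ge (F := F)
    rw [← hq] at h3 h4
    have h5 : q ≤ 2 * (q - 1) := by omega
    have hq0 : 0 < q := by omega
    refine Nat.le_of_mul_le_mul_left ?_ hq0
    calc q * (q ^ 2 * A.card) ≤ 2 * (q - 1) * (q ^ 2 * A.card) := by gcongr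
      _ = 2 * ((q - 1) * q ^ 2 * A.card) := by ring
      _ ≤ 2 * (Fintype.card (SpecialLinearGroup (Fin 2) F) * A.card) := by gcongr
      _ ≤ 2 * (8 * (2 * R ^ 2) * q * (wordBall A 2).card) := by gcongr
      _ ≤ 2 * (8 * (2 * R ^ 2) * q * W) := by gcongr; exact hle 2 (by norm_num)
      _ = q * (32 * R ^ 2 * W) := by ring
  refine growth_arith hNpos hNW hτ1 hτ3 hRle hsmall ?_
  rcases Nat.lt_or_ge A.card (4 * (2 * R ^ 2)) with h | h
  · left; omega
  · exact Or.inr (hpivot h)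

end Growth

/-! ### Iterating growth -/

section Iteration

variable {G : Type*} [Group G] [DecidableEq G] {A : Finset G}

lemma IsSymmGenSet.wordBall_isSymmGenSet (hA : IsSymmGenSet A) {n : ℕ} (hn : n ≠ 0) :
    IsSymmGenSet (wordBall A n) := by
  have hsub : A ⊆ wordBall A n := fun a ha =>
    hA.wordBall_mono (Nat.one_le_iff_ne_zero.2 hn) (mem_wordBall_one.2 ha)
  refine ⟨hsub hA.one_mem, ?_, ?_⟩
  · ext g
    rw [Finset.mem_inv']
    exact ⟨fun h => by simpa using hA.inv_mem_wordBall h, hA.inv_mem_wordBall⟩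
  · rw [eq_top_iff, ← hA.closure_eq]
    exact Subgroup.closure_mono (Finset.coe_subset.2 hsub)

/-- A ball that equals the next one is stable under multiplication by `A`, hence is the whole group;
until then every step adds an element. -/
lemma IsSymmGenSet.lt_card_wordBall [Fintype G] (hA : IsSymmGenSet A) (n : ℕ)
    (hn : wordBall A n ≠ Finset.univ) : n < (wordBall A n).card := by
  induction n with
  | zero => simp [wordBall_zero]
  | succ n ih =>
    have hsub : wordBall A n ⊆ wordBall A (n + 1) := hA.wordBall_mono (Nat.le_succ n)
    have hne : wordBall A n ≠ Finset.univ := fun h =>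
      hn (Finset.univ_subset_iff.1 (h ▸ hsub))
    have hss : wordBall A n ⊂ wordBall A (n + 1) := by
      refine lt_of_le_of_ne hsub fun heq => hne ?_
      have hst : ∀ m, wordBall A m ⊆ wordBall A n := by
        intro m
        induction m with
        | zero => exact hA.wordBall_mono (Nat.zero_le n)
        | succ m ihm =>
          intro g hg
          obtain ⟨a, ha, h, hh, rfl⟩ := exists_of_mem_wordBall_succ hg
          rw [heq]
          exact mul_mem_wordBall (mem_wordBall_one.2 ha) (ihm hh) (by omega)
      refine Finset.eq_univ_of_forall fun g => ?_
      obtain ⟨m, hm⟩ := hA.exists_mem_wordBall g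
      exact hst m hm
    have := Finset.card_lt_card hss
    have := ih hne
    omega

end Iteration

section Iteration

variable {F : Type*} [Field F] [Fintype F] [DecidableEq F]
  {A : Finset (SpecialLinearGroup (Fin 2) F)}

/-- Growth gives `45 log N ≤ 187 log 2 + 44 log W`. Starting at radius `T ≥ 2 ^ 374` makes `187 log
2 ≤ (log N) / 2`, so each step multiplies the logarithm by at least `44.5 / 44 = 89 / 88`. -/
lemma IsSymmGenSet.pow_le_log_card (hA : IsSymmGenSet A) (hF : 3 < Fintype.card F)
    (h2 : (2 : F) ≠ 0) {T : ℕ} (hT : (2 ^ 187) ^ 2 ≤ T) (i : ℕ)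
    (hi : wordBall A (T * 156 ^ i) ≠ Finset.univ) :
    (89 / 88 : ℝ) ^ i ≤ Real.log (wordBall A (T * 156 ^ i)).card := by
  have hT0 : T ≠ 0 := by
    rintro rfl
    norm_num at hT
  have hlogT : 374 * Real.log 2 ≤ Real.log T := by
    have h1 : (((2 : ℝ) ^ 187) ^ 2) ≤ T := by exact_mod_cast hT
    have h3 := Real.log_le_log (by positivity) h1
    rw [Real.log_pow, Real.log_pow] at h3
    push_cast at h3
    linarith
  have hbig : ∀ j, wordBall A (T * 156 ^ j) ≠ Finset.univ →
      Real.log T ≤ Real.log (wordBall A (T * 156 ^ j)).card := by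
    intro j hj
    have h1 : T ≤ (wordBall A (T * 156 ^ j)).card :=
      (Nat.le_mul_of_pos_right T (by positivity)).trans (hA.lt_card_wordBall _ hj).le
    exact Real.log_le_log (by positivity) (by exact_mod_cast h1)
  have hlog2 := Real.log_two_gt_d9
  induction i with
  | zero =>
    have := hbig 0 hi
    rw [pow_zero]
    linarith
  | succ i ih =>
    have hstep : wordBall A (T * 156 ^ (i + 1)) = wordBall (wordBall A (T * 156 ^ i)) 156 := by
      rw [wordBall_wordBall, pow_succ, mul_assoc]
    have hne : wordBall A (T * 156 ^ i) ≠ Finset.univ := by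
      intro h
      refine hi (Finset.univ_subset_iff.1 ?_)
      rw [← h]
      exact hA.wordBall_mono (Nat.mul_le_mul_left T (Nat.pow_le_pow_right (by norm_num) (by omega)))
    have ih := ih hne
    have hN := hbig i hne
    have hB := hA.wordBall_isSymmGenSet (n := T * 156 ^ i) (by positivity)
    rw [hstep] at hi ⊢
    have hg := hB.growth hF h2 hi
    have hNpos : 0 < (wordBall A (T * 156 ^ i)).card := Finset.card_pos.2 ⟨1, hB.one_mem⟩
    generalize (wordBall A (T * 156 ^ i)).card = N at *
    have hWpos : 0 < (wordBall (wordBall A (T * 156 ^ i)) 156).card := by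
      by_contra h
      have h0 : (wordBall (wordBall A (T * 156 ^ i)) 156).card = 0 := by omega
      rw [h0, zero_pow (by norm_num), mul_zero] at hg
      exact absurd hg (by have := Nat.pow_pos (n := 45) hNpos; omega)
    generalize (wordBall (wordBall A (T * 156 ^ i)) 156).card = W at *
    have hN0 : (0 : ℝ) < N := by exact_mod_cast hNpos
    have hW0 : (0 : ℝ) < W := by exact_mod_cast hWpos
    have hg' : (N : ℝ) ^ 45 ≤ 2 ^ 187 * (W : ℝ) ^ 44 := by exact_mod_cast hg
    have h3 := Real.log_le_log (by positivity) hg'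
    rw [Real.log_mul (by positivity) (by positivity), Real.log_pow, Real.log_pow,
      Real.log_pow] at h3
    push_cast at h3
    rw [pow_succ]
    linarith

end Iteration

/-! ### From balls to walks in the Cayley graph -/

section Cayley

variable {G : Type*} [Group G]

/-- The symmetrization of a set of group elements, with the identity added. -/
noncomputable def symmetrization [Finite G] (A : Set G) : Finset G :=
  (Set.toFinite (A ∪ A⁻¹ ∪ {1})).toFinset

lemma mem_symmetrization [Finite G] {A : Set G} {g : G} :
    g ∈ symmetrization A ↔ g ∈ A ∨ g⁻¹ ∈ A ∨ g = 1 := by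
  simp only [symmetrization, Set.Finite.mem_toFinset, Set.mem_union, Set.mem_inv,
    Set.mem_singleton_iff, or_assoc]

variable [DecidableEq G]

lemma isSymmGenSet_symmetrization [Finite G] {A : Set G} (hA : Subgroup.closure A = ⊤) :
    IsSymmGenSet (symmetrization A) := by
  refine ⟨mem_symmetrization.2 (Or.inr (Or.inr rfl)), ?_, ?_⟩
  · ext g
    rw [Finset.mem_inv', mem_symmetrization, mem_symmetrization, inv_inv, inv_eq_one]
    tauto
  · rw [eq_top_iff, ← hA]
    exact Subgroup.closure_mono fun a ha => mem_symmetrization.2 (Or.inl ha)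

lemma exists_walk_of_mem_wordBall [Finite G] {A : Set G} {n : ℕ} {g : G}
    (hg : g ∈ wordBall (symmetrization A) n) (v : G) :
    ∃ w : (cayleyGraph A).Walk (g * v) v, w.length ≤ n := by
  induction n generalizing g with
  | zero =>
    rw [wordBall_zero, Finset.mem_singleton] at hg
    subst hg
    rw [one_mul]
    exact ⟨SimpleGraph.Walk.nil, le_rfl⟩
  | succ n ih =>
    obtain ⟨a, ha, h, hh, rfl⟩ := exists_of_mem_wordBall_succ hg
    obtain ⟨w, hw⟩ := ih hh
    rw [mul_assoc]
    by_cases heq : a * (h * v) = h * v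
    · rw [heq]
      exact ⟨w, by omega⟩
    · have hadj : (cayleyGraph A).Adj (a * (h * v)) (h * v) := by
        rw [cayleyGraph, SimpleGraph.fromRel_adj]
        refine ⟨heq, ?_⟩
        rcases mem_symmetrization.1 ha with ha | ha | ha
        · exact Or.inl ⟨a, ha, rfl⟩
        · exact Or.inr ⟨a⁻¹, ha, by rw [inv_mul_cancel_left]⟩
        · exact absurd (by rw [ha, one_mul]) heq
      exact ⟨SimpleGraph.Walk.cons hadj w, by rw [SimpleGraph.Walk.length_cons]; omega⟩

lemma cayleyGraph_connected_and_diam_le [Fintype G] {A : Set G} {n : ℕ}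
    (h : wordBall (symmetrization A) n = Finset.univ) :
    (cayleyGraph A).Connected ∧ (cayleyGraph A).diam ≤ n := by
  have hwalk : ∀ u v, ∃ w : (cayleyGraph A).Walk u v, w.length ≤ n := by
    intro u v
    have := exists_walk_of_mem_wordBall (A := A) (n := n) (g := u * v⁻¹)
      (h ▸ Finset.mem_univ _) v
    rwa [inv_mul_cancel_right] at this
  refine ⟨⟨fun u v => ⟨(hwalk u v).choose⟩⟩, ?_⟩
  obtain ⟨u, v, huv⟩ := SimpleGraph.exists_dist_eq_diam (G := cayleyGraph A)
  obtain ⟨w, hw⟩ := hwalk u v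
  rw [← huv]
  exact (SimpleGraph.dist_le w).trans hw

end Cayley

/-! ### The diameter bound -/

/-- The exponent of the logarithm in the diameter bound. -/
noncomputable def diamExponent : ℝ := Real.log 156 / Real.log (89 / 88)

lemma diamExponent_pos : 0 < diamExponent :=
  div_pos (Real.log_pos (by norm_num)) (Real.log_pos (by norm_num))

/-- With `x` the logarithm of `y` to base `89 / 88`, the integer `⌈x⌉₊ + 1` lies strictly between
`x` and `x + 2`; the excess costs the factor `156 ^ 2`. -/
lemma exists_pow_gt_and_pow_le {y : ℝ} (hy : 1 ≤ y) :
    ∃ i : ℕ, y < (89 / 88 : ℝ) ^ i ∧ (156 : ℝ) ^ i ≤ 156 ^ 2 * y ^ diamExponent := by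
  have hβ : 0 < Real.log (89 / 88) := Real.log_pos (by norm_num)
  have hy0 : 0 < y := by linarith
  set x := Real.log y / Real.log (89 / 88) with hx
  have hx0 : 0 ≤ x := div_nonneg (Real.log_nonneg hy) hβ.le
  have hyx : (89 / 88 : ℝ) ^ x = y := by
    rw [Real.rpow_def_of_pos (by norm_num), hx, mul_div_cancel₀ _ hβ.ne', Real.exp_log hy0]
  have hyc : (156 : ℝ) ^ x = y ^ diamExponent := by
    rw [Real.rpow_def_of_pos (by norm_num), Real.rpow_def_of_pos hy0, hx, diamExponent]
    congr 1
    ring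
  refine ⟨⌈x⌉₊ + 1, ?_, ?_⟩
  · rw [← hyx, ← Real.rpow_natCast]
    refine Real.rpow_lt_rpow_of_exponent_lt (by norm_num) ?_
    push_cast
    have := Nat.le_ceil x
    linarith
  · rw [← hyc, ← Real.rpow_natCast, ← Real.rpow_natCast 156 2,
      ← Real.rpow_add (by norm_num : (0 : ℝ) < 156)]
    refine Real.rpow_le_rpow_of_exponent_le (by norm_num) ?_
    push_cast
    have := Nat.ceil_lt_add_one hx0
    linarith

theorem mainTheorem1 :
    ∃ c C : ℝ, 0 < c ∧ 0 < C ∧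
      ∀ (p : ℕ) [Fact p.Prime] (A : Set (Matrix.SpecialLinearGroup (Fin 2) (ZMod p))),
        Subgroup.closure A = ⊤ →
          (cayleyGraph A).Connected ∧
          ((cayleyGraph A).diam : ℝ) ≤ C * Real.log (p : ℝ) ^ c ∧
          ((cayleyGraph A).diam : ℝ) ≤
            C * Real.log (Nat.card (Matrix.SpecialLinearGroup (Fin 2) (ZMod p)) : ℝ) ^ c := by
  obtain ⟨T, hT⟩ : ∃ T : ℕ, T = (2 ^ 187) ^ 2 := ⟨_, rfl⟩
  have hT81 : 81 ≤ T := by rw [hT]; norm_num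
  have hT0 : (0 : ℝ) < T := by exact_mod_cast (by omega : 0 < T)
  have hc := diamExponent_pos
  refine ⟨diamExponent, T * (156 ^ 2 * 4 ^ diamExponent), hc, by positivity, ?_⟩
  intro p hp A hA
  have hp2 : 2 ≤ p := hp.out.two_le
  have hp2' : (2 : ℝ) ≤ p := by exact_mod_cast hp2
  have hlogp : Real.log 2 ≤ Real.log p := Real.log_le_log (by norm_num) hp2'
  have hlog2 := Real.log_two_gt_d9
  have hlog0 : 0 ≤ Real.log p := by linarith
  obtain ⟨i, hi, hi'⟩ := exists_pow_gt_and_pow_le (y := 4 * Real.log p) (by linarith)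
  have hS := isSymmGenSet_symmetrization hA
  have hG : Fintype.card (SpecialLinearGroup (Fin 2) (ZMod p)) ≤ p ^ 4 := by
    have := card_sl2_le (F := ZMod p)
    rwa [ZMod.card] at this
  have huniv : wordBall (symmetrization A) (T * 156 ^ i) = Finset.univ := by
    by_contra hne
    have hle := (wordBall (symmetrization A) (T * 156 ^ i)).card_le_univ.trans hG
    -- For `p ≤ 3` the growth theorem does not apply, but `p ^ 4 ≤ 81 ≤ T`, so a ball of radius at
    -- least `T` already exhausts the group.
    rcases le_or_gt p 3 with hp3 | hp3
    · have h1 := hS.lt_card_wordBall _ hne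
      have h3 : T ≤ T * 156 ^ i := Nat.le_mul_of_pos_right T (by positivity)
      have h4 : p ^ 4 ≤ 3 ^ 4 := Nat.pow_le_pow_left hp3 4
      omega
    · have h20 : (2 : ZMod p) ≠ 0 := by
        intro h
        have h' : ((2 : ℕ) : ZMod p) = 0 := by exact_mod_cast h
        rw [ZMod.natCast_eq_zero_iff] at h'
        have := Nat.le_of_dvd (by norm_num) h'
        omega
      have h1 := hS.pow_le_log_card (by rwa [ZMod.card]) h20 hT.ge i hne
      have hpos : 0 < (wordBall (symmetrization A) (T * 156 ^ i)).card :=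
        (Nat.zero_le _).trans_lt (hS.lt_card_wordBall _ hne)
      have h3 : Real.log (wordBall (symmetrization A) (T * 156 ^ i)).card ≤
          4 * Real.log p := by
        have h4 : ((wordBall (symmetrization A) (T * 156 ^ i)).card : ℝ) ≤ (p : ℝ) ^ 4 := by
          exact_mod_cast hle
        have h5 := Real.log_le_log (by exact_mod_cast hpos) h4
        rw [Real.log_pow] at h5
        exact_mod_cast h5
      linarith
  obtain ⟨hconn, hdiam⟩ := cayleyGraph_connected_and_diam_le huniv
  have hbound : ((cayleyGraph A).diam : ℝ) ≤
      T * (156 ^ 2 * 4 ^ diamExponent) * Real.log p ^ diamExponent := by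
    calc ((cayleyGraph A).diam : ℝ) ≤ ((T * 156 ^ i : ℕ) : ℝ) := by exact_mod_cast hdiam
      _ = T * 156 ^ i := by push_cast; rfl
      _ ≤ T * (156 ^ 2 * (4 * Real.log p) ^ diamExponent) := by gcongr
      _ = _ := by rw [Real.mul_rpow (by norm_num) hlog0]; ring
  refine ⟨hconn, hbound, hbound.trans ?_⟩
  have hpG : p ≤ Nat.card (SpecialLinearGroup (Fin 2) (ZMod p)) := by
    rw [Nat.card_eq_fintype_card]
    refine le_trans ?_ (card_sl2_ge (F := ZMod p))
    rw [ZMod.card]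
    have h1 : 1 ≤ p - 1 := by omega
    nlinarith
  have hlogG : Real.log p ≤ Real.log (Nat.card (SpecialLinearGroup (Fin 2) (ZMod p))) :=
    Real.log_le_log (by linarith) (by exact_mod_cast hpG)
  gcongr
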